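/- Consider the three-field Kaup–Boussinesq system for functions $u,v,w$ of $(x,t)$: $$u_t-\tfrac32uu_x-v_x=0,\qquad v_t-vu_x-\tfrac12uv_x-w_x=0,\qquad w_t+\tfrac14u_{xxx}-wu_x-\tfrac12uw_x=0,$$ and write its left-hand sides as $\Delta=(\Delta_1,\Delta_2,\Delta_3)$. Let $U\subseteq\mathbb R^5$ be a nonempty connected open set in the space of the variables $(x,t,u,v,w)$, and let $$V=\xi\,\partial_x+\tau\,\partial_t+\eta_1\,\partial_u+\eta_2\,\partial_v+\eta_3\,\partial_w$$ be a smooth real vector field on $U$. Call $V$ a (generator of a) Lie point symmetry of the system on $U$ if its third prolongation satisfies $V^{(3)}(\Delta)=0$ at every third-order jet over $U$ that satisfies the system and all its differential consequences of order at most three. 1. $V$ is a Lie point symmetry on $U$ if and only if there are real constants $c_1,c_2,c_3,c_4$ such that on $U$ $$\xi=-\tfrac{5c_3}{6}t+\tfrac{3c_1}{5}x+c_4,\quad \tau=c_1t+c_2,\quad \eta_1=-\tfrac{2c_1}{5}u+c_3,\quad \eta_2=-\tfrac{4c_1}{5}v-\tfrac{2c_3}{3}u,\quad \eta_3=-\tfrac{c_3}{3}v-\tfrac{6c_1}{5}w.$$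 The same equivalence holds if $V^{(3)}(\Delta)=0$ is required at all third-order jets over $U$ that satisfy $\Delta=0$ alone. 2. The Lie point symmetries on $U$ form a Lie subalgebra of the Lie algebra of smooth vector fields on $U$. It has dimension four, with a basis consisting of the (restrictions to $U$ of the) two translations $V_1=\partial_t$ and $V_2=\partial_x$, the Galilean boost $V_3=-\tfrac{5t}{6}\partial_x+\partial_u-\tfrac{2u}{3}\partial_v-\tfrac v3\partial_w$ and the dilation $V_4=\tfrac{3x}{5}\partial_x+t\,\partial_t-\tfrac{2u}{5}\partial_u-\tfrac{4v}{5}\partial_v-\tfrac{6w}{5}\partial_w$. The brackets are $$[V_1,V_3]=-\tfrac56V_2,\quad [V_1,V_4]=V_1,\quad [V_2,V_4]=\tfrac35V_2,\quad [V_3,V_4]=-\tfrac25V_3,\quad [V_1,V_2]=[V_2,V_3]=0.$$ 3. This Lie algebra is solvable. -/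

import Mathlib

open scoped ContDiff

noncomputable section

namespace KaupBoussinesq

/-! ### Jet space of maps `(x, t) ↦ (u, v, w)` -/

/-- The space of the variables `(x, t, u, v, w)`, with coordinates `0, 1, 2, 3, 4` in this order. -/
abbrev Base : Type := Fin 5 → ℝ

/-- Labels of the jet coordinates. `Sum.inl 0` is `x`, `Sum.inl 1` is `t`, and `Sum.inr (α, i, j)`
is the derivative of order `i` in `x` and `j` in `t` of the dependent variable number `α`,
where `u, v, w` have the numbers `0, 1, 2`. -/
abbrev JetIndex : Type := Fin 2 ⊕ (Fin 3 × ℕ × ℕ)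

/-- Jet coordinates of all orders. All functions considered below depend on finitely many of them;
a function of order `n` depends only on `x`, `t` and the `Sum.inr (α, i, j)` with `i + j ≤ n`. -/
abbrev Jet : Type := JetIndex → ℝ

/-- The point `(x, t, u, v, w)` below a jet. -/
def basePoint (z : Jet) : Base :=
  ![z (Sum.inl 0), z (Sum.inl 1),
    z (Sum.inr (0, 0, 0)), z (Sum.inr (1, 0, 0)), z (Sum.inr (2, 0, 0))]

/-- Partial derivative of a function on jet space with respect to one jet coordinate. -/
def pderiv (a : JetIndex) (F : Jet → ℝ) (z : Jet) : ℝ :=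
  deriv (fun s : ℝ => F (Function.update z a s)) (z a)

/-- The multi-index `(i, j)` with one more derivative in the independent variable `k`
(`k = 0` is `x`, `k = 1` is `t`). -/
def bump (k : Fin 2) (J : ℕ × ℕ) : ℕ × ℕ :=
  if k = 0 then (J.1 + 1, J.2) else (J.1, J.2 + 1)

/-- Total derivative `D_k F = ∂F/∂x^k + ∑ u^α_{J,k} ∂F/∂u^α_J` of a function `F` of order `n`;
the sum is over the dependent variables and over all multi-indices of order at most `n`. -/
def totalDeriv (n : ℕ) (k : Fin 2) (F : Jet → ℝ) (z : Jet) : ℝ :=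
  pderiv (Sum.inl k) F z +
    ∑ α : Fin 3, ∑ m ∈ Finset.range (n + 1), ∑ J ∈ Finset.HasAntidiagonal.antidiagonal m,
      z (Sum.inr (α, bump k J)) * pderiv (Sum.inr (α, J)) F z

/-- `D_t ^ j F` for a function `F` of order `n`. -/
def iterTotalDerivT (n : ℕ) (F : Jet → ℝ) : ℕ → Jet → ℝ
  | 0 => F
  | j + 1 => totalDeriv (n + j) 1 (iterTotalDerivT n F j)

/-- `D_x ^ i D_t ^ j F` for a function `F` of order `n`. -/
def iterTotalDeriv (n : ℕ) (F : Jet → ℝ) : ℕ → ℕ → Jet → ℝ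
  | 0, j => iterTotalDerivT n F j
  | i + 1, j => totalDeriv (n + i + j) 0 (iterTotalDeriv n F i j)

/-! ### Prolongation of vector fields -/

/-- One step of the prolongation formula
`φ^α_{J,k} = D_k φ^α_J - (D_k ξ) u^α_{J,x} - (D_k τ) u^α_{J,t}` for the vector field
`V = ξ ∂_x + τ ∂_t + η₁ ∂_u + η₂ ∂_v + η₃ ∂_w`, with `ξ = V · 0` and `τ = V · 1`. -/
def prolongStep (V : Base → Base) (α : Fin 3) (k : Fin 2) (J : ℕ × ℕ) (φ : Jet → ℝ) (z : Jet) : ℝ :=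
  totalDeriv (J.1 + J.2) k φ z
    - totalDeriv 0 k (fun y => V (basePoint y) 0) z * z (Sum.inr (α, bump 0 J))
    - totalDeriv 0 k (fun y => V (basePoint y) 1) z * z (Sum.inr (α, bump 1 J))

/-- The coefficient of `∂/∂u^α_{(0, j)}` in the prolongation of `V`; for `j = 0` it is `η_{α + 1}`,
the component number `2 + α` of `V`. -/
def prolongCoeffT (V : Base → Base) (α : Fin 3) : ℕ → Jet → ℝ
  | 0 => fun z => V (basePoint z) (Fin.natAdd 2 α)
  | j + 1 => prolongStep V α 1 (0, j) (prolongCoeffT V α j)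

/-- The coefficient of `∂/∂u^α_{(i, j)}` in the prolongation of `V`. -/
def prolongCoeff (V : Base → Base) (α : Fin 3) : ℕ → ℕ → Jet → ℝ
  | 0, j => prolongCoeffT V α j
  | i + 1, j => prolongStep V α 0 (i, j) (prolongCoeff V α i j)

/-- The `n`-th prolongation of the vector field `V`, applied to a function `F` of order `n`. -/
def prolong (n : ℕ) (V : Base → Base) (F : Jet → ℝ) (z : Jet) : ℝ :=
  V (basePoint z) 0 * pderiv (Sum.inl 0) F z + V (basePoint z) 1 * pderiv (Sum.inl 1) F z +
    ∑ α : Fin 3, ∑ m ∈ Finset.range (n + 1), ∑ J ∈ Finset.HasAntidiagonal.antidiagonal m,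
      prolongCoeff V α J.1 J.2 z * pderiv (Sum.inr (α, J)) F z

/-! ### The three-field Kaup–Boussinesq system and its point symmetries -/

/-- The left-hand sides of the system
`u_t - (3/2) u u_x - v_x = 0`, `v_t - v u_x - (1/2) u v_x - w_x = 0`,
`w_t + (1/4) u_xxx - w u_x - (1/2) u w_x = 0`, as functions on jet space. -/
def system : Fin 3 → Jet → ℝ :=
  let u : ℕ → ℕ → Jet → ℝ := fun i j z => z (Sum.inr (0, i, j))
  let v : ℕ → ℕ → Jet → ℝ := fun i j z => z (Sum.inr (1, i, j))
  let w : ℕ → ℕ → Jet → ℝ := fun i j z => z (Sum.inr (2, i, j))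
  ![fun z => u 0 1 z - 3 / 2 * u 0 0 z * u 1 0 z - v 1 0 z,
    fun z => v 0 1 z - v 0 0 z * u 1 0 z - 1 / 2 * u 0 0 z * v 1 0 z - w 1 0 z,
    fun z => w 0 1 z + 1 / 4 * u 3 0 z - w 0 0 z * u 1 0 z - 1 / 2 * u 0 0 z * w 1 0 z]

/-- The orders of the three equations. -/
def systemOrder : Fin 3 → ℕ := ![1, 1, 3]

/-- The jets that satisfy the three equations. -/
def systemLocus : Set Jet := {z | ∀ k, system k z = 0}

/-- The jets that satisfy the three equations together with all their differential consequences
`D_x ^ i D_t ^ j Δ_k = 0` of order at most three. -/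
def prolongedLocus : Set Jet :=
  {z | ∀ (k : Fin 3) (i j : ℕ), systemOrder k + i + j ≤ 3 →
    iterTotalDeriv (systemOrder k) (system k) i j z = 0}

/-- The third prolongation of `V`, applied to the system, vanishes at all jets in `S` that lie
over `U`. -/
def PreservesSystemOn (S : Set Jet) (U : Set Base) (V : Base → Base) : Prop :=
  ∀ z ∈ S, basePoint z ∈ U → ∀ k, prolong 3 V (system k) z = 0

/-- `V` is the infinitesimal generator on `U` of a Lie point symmetry of the system: its third
prolongation annihilates the system modulo the system and its differential consequences. -/
def IsPointSymmetry (U : Set Base) (V : Base → Base) : Prop :=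
  PreservesSystemOn prolongedLocus U V

/-- The infinitesimals `(ξ, τ, η₁, η₂, η₃)` with the parameters `c₁, c₂, c₃, c₄`, at the point
`p = (x, t, u, v, w)`. -/
def infinitesimals (c₁ c₂ c₃ c₄ : ℝ) (p : Base) : Base :=
  ![-(5 * c₃ / 6) * p 1 + 3 * c₁ / 5 * p 0 + c₄,
    c₁ * p 1 + c₂,
    -(2 * c₁ / 5) * p 2 + c₃,
    -(4 * c₁ / 5) * p 3 - 2 * c₃ / 3 * p 2,
    -(c₃ / 3) * p 3 - 6 * c₁ / 5 * p 4]

/-! ### The Lie algebra of smooth vector fields on an open set -/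

/-- Smooth vector fields on the open set `U`; outside `U` they are given the value `0`, so that
two of them are equal exactly when they agree on `U`. -/
def smoothFields (U : TopologicalSpace.Opens Base) : Submodule ℝ (Base → Base) where
  carrier := {V | ContDiffOn ℝ ∞ V U ∧ ∀ p, p ∉ U → V p = 0}
  add_mem' := by
    rintro V W ⟨hV, hV'⟩ ⟨hW, hW'⟩
    exact ⟨hV.add hW, fun p hp => by simp [hV' p hp, hW' p hp]⟩
  zero_mem' := ⟨contDiffOn_const, fun _ _ => rfl⟩
  smul_mem' := by
    rintro c V ⟨hV, hV'⟩
    exact ⟨contDiffOn_const.smul hV, fun p hp => by simp [hV' p hp]⟩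

/-- Smooth vector fields on `U`, as a type. -/
abbrev SmoothField (U : TopologicalSpace.Opens Base) : Type := smoothFields U

variable {U : TopologicalSpace.Opens Base}

theorem SmoothField.contDiffAt (V : SmoothField U) {p : Base} (hp : p ∈ U) :
    ContDiffAt ℝ ∞ V.1 p :=
  V.2.1.contDiffAt (U.isOpen.mem_nhds hp)

theorem SmoothField.differentiableAt (V : SmoothField U) {p : Base} (hp : p ∈ U) :
    DifferentiableAt ℝ V.1 p :=
  (V.contDiffAt hp).differentiableAt (by simp)

/-- The Lie bracket `[V, W] p = DW(p) (V p) - DV(p) (W p)` of vector fields. -/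
instance : Bracket (SmoothField U) (SmoothField U) where
  bracket V W := ⟨VectorField.lieBracket ℝ V.1 W.1,
    fun _ hp => ((V.contDiffAt hp).lieBracket_vectorField (W.contDiffAt hp)
      (m := ∞) (by simp)).contDiffWithinAt,
    fun p hp => VectorField.lieBracket_eq_zero_of_eq_zero (V.2.2 p hp) (W.2.2 p hp)⟩

theorem SmoothField.coe_bracket (V W : SmoothField U) :
    (⁅V, W⁆ : SmoothField U).1 = VectorField.lieBracket ℝ V.1 W.1 := rfl

theorem SmoothField.ext_on {V W : SmoothField U} (h : ∀ p ∈ U, V.1 p = W.1 p) : V = W := by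
  apply Subtype.ext
  funext p
  by_cases hp : p ∈ U
  · exact h p hp
  · rw [V.2.2 p hp, W.2.2 p hp]

instance : LieRing (SmoothField U) where
  add_lie V W X := SmoothField.ext_on fun p hp => by
    exact VectorField.lieBracket_add_left (V.differentiableAt hp) (W.differentiableAt hp)
  lie_add V W X := SmoothField.ext_on fun p hp => by
    exact VectorField.lieBracket_add_right (W.differentiableAt hp) (X.differentiableAt hp)
  lie_self V := SmoothField.ext_on fun p _ => by
    rw [SmoothField.coe_bracket, VectorField.lieBracket_self]
    rfl
  leibniz_lie V W X := SmoothField.ext_on fun p hp => by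
    exact VectorField.leibniz_identity_lieBracket (n := ∞) (by simpa using WithTop.coe_le_coe.2 (le_top : (2 : ℕ∞) ≤ ⊤))
      (V.contDiffAt hp) (W.contDiffAt hp) (X.contDiffAt hp)

instance : LieAlgebra ℝ (SmoothField U) where
  lie_smul c V W := SmoothField.ext_on fun p hp => by
    exact VectorField.lieBracket_const_smul_right (W.differentiableAt hp)

/-- The restriction to `U` of a smooth vector field on the whole space. -/
def restrictField (U : TopologicalSpace.Opens Base) (V : Base → Base) (hV : ContDiff ℝ ∞ V) :
    SmoothField U := by
  classical
  exact ⟨fun p => if p ∈ U then V p else 0,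
    hV.contDiffOn.congr fun p hp => if_pos hp, fun p hp => if_neg hp⟩

/-- `V₁ = ∂_t` (translation). -/
def V₁ (U : TopologicalSpace.Opens Base) : SmoothField U :=
  restrictField U (fun _ => ![0, 1, 0, 0, 0]) contDiff_const

/-- `V₂ = ∂_x` (translation). -/
def V₂ (U : TopologicalSpace.Opens Base) : SmoothField U :=
  restrictField U (fun _ => ![1, 0, 0, 0, 0]) contDiff_const

/-- `V₃ = -(5 t / 6) ∂_x + ∂_u - (2 u / 3) ∂_v - (v / 3) ∂_w` (Galilean boost). -/
def V₃ (U : TopologicalSpace.Opens Base) : SmoothField U :=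
  restrictField U (fun p => ![-(5 * p 1 / 6), 0, 1, -(2 * p 2 / 3), -(p 3 / 3)]) (by
    rw [contDiff_pi]
    intro i
    fin_cases i <;> simp <;> fun_prop)

/-- `V₄ = (3 x / 5) ∂_x + t ∂_t - (2 u / 5) ∂_u - (4 v / 5) ∂_v - (6 w / 5) ∂_w` (dilation). -/
def V₄ (U : TopologicalSpace.Opens Base) : SmoothField U :=
  restrictField U (fun p =>
    ![3 * p 0 / 5, p 1, -(2 * p 2 / 5), -(4 * p 3 / 5), -(6 * p 4 / 5)]) (by
    rw [contDiff_pi]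
    intro i
    fin_cases i <;> simp <;> fun_prop)

end KaupBoussinesq

end

/-!
The symmetry condition is an identity between functions on jet space, and the proof turns it into an
overdetermined linear system of partial differential equations for the five components of `V`.

*The prolongation.* Total derivatives and prolonged vector fields are both derivations on functions
of finitely many jet coordinates; `HasJetDeriv` records such a derivative together with the
differentiability that the product rule needs. With it the prolongation coefficients that occur are
computed in terms of `D_x ^ i` (`i ≤ 3`) and `D_t` of the components, which leads to the formulas
`prolong_system_zero_eq`, `prolong_system_one_eq`, `prolong_system_two_eq`.

*Necessity.* The system and its differential consequences of order at most three can be solved for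
the derivatives involving `t`, so over each base point there are jets in the prolonged locus with
prescribed `u_x, v_x, w_x, u_xx, u_xxx, v_xxx` (`exists_mem_prolongedLocus`). In particular `w_t` is
free as far as the first-order jet is concerned. Comparing coefficients of these free parameters,
* `w_t` and `w_x` in the first two equations give `τ_u = τ_v = τ_w = 0`, `ξ_v = ξ_w = 0` and
  `∂_v η₁ = -2 τ_x`, while `v_xxx` in the third gives `∂_v η₁ = 3 τ_x`; hence `τ = τ(t)`;
* `u_xx ^ 2` and `u_xxx` in the third equation give `ξ_u = 0` and `5 ξ_x = 3 τ_t`;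
* the coefficients of `u_x, v_x, w_x` then express `η₁, η₂, η₃` algebraically through `ξ_t` and
  `τ_t` (`eta_one_conditions`, `eta_two_three`);
* the terms free of derivatives in the first equation give `τ_tt = ξ_tt = 0`.

Since `U` is connected, `τ_t`, `ξ_t` and the remaining integration constants are constant on `U`
(`exists_eq_infinitesimals`).

*Sufficiency.* The components of the known infinitesimals are affine functions, and the prolonged
field sends each equation to a linear combination of the equations, at all jets
(`preservesSystemOn_systemLocus`). As the prolonged locus is contained in the locus of the system,
both versions of the symmetry condition are equivalent to the explicit form.

*The Lie algebra.* In terms of the four parameters the bracket is `bracketCoeff`, and the parameters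
are determined by the field. The derived series loses the dilation, then the time translation and
the boost, and then the space translation.
-/

open scoped ContDiff

/-! ### Differentiation on jet space along a vector field -/

namespace KaupBoussinesq

/-- The combination `∑ c_a P_a` over the two independent variables and all jet coordinates of order
at most `n`. Applied to the partial derivatives of a function it gives the derivative along the
vector field on jet space with coefficients `c`. -/
noncomputable def jetSum (n : ℕ) (c P : JetIndex → ℝ) : ℝ :=
  c (Sum.inl 0) * P (Sum.inl 0) + c (Sum.inl 1) * P (Sum.inl 1) +
    ∑ α : Fin 3, ∑ m ∈ Finset.range (n + 1), ∑ J ∈ Finset.HasAntidiagonal.antidiagonal m,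
      c (Sum.inr (α, J)) * P (Sum.inr (α, J))

theorem jetSum_add (n : ℕ) (c P Q : JetIndex → ℝ) :
    jetSum n c (fun a => P a + Q a) = jetSum n c P + jetSum n c Q := by
  simp only [jetSum, mul_add, Finset.sum_add_distrib]
  ring

theorem jetSum_const_mul (n : ℕ) (c P : JetIndex → ℝ) (r : ℝ) :
    jetSum n c (fun a => r * P a) = r * jetSum n c P := by
  simp only [jetSum, mul_add, Finset.mul_sum, mul_left_comm]

theorem jetSum_zero (n : ℕ) (c : JetIndex → ℝ) : jetSum n c (fun _ => 0) = 0 := by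
  simp [jetSum]

theorem jetSum_single_inl (n : ℕ) (c : JetIndex → ℝ) (k : Fin 2) :
    jetSum n c (Pi.single (Sum.inl k) 1) = c (Sum.inl k) := by
  fin_cases k <;> simp [jetSum]

theorem jetSum_single_inr (n : ℕ) (c : JetIndex → ℝ) (α : Fin 3) (J : ℕ × ℕ) (h : J.1 + J.2 ≤ n) :
    jetSum n c (Pi.single (Sum.inr (α, J)) 1) = c (Sum.inr (α, J)) := by
  have hin : ∀ β : Fin 3, ∀ m, ∑ K ∈ Finset.HasAntidiagonal.antidiagonal m,
      c (Sum.inr (β, K)) * (Pi.single (Sum.inr (α, J)) 1 : JetIndex → ℝ) (Sum.inr (β, K)) =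
      if β = α then (if m = J.1 + J.2 then c (Sum.inr (α, J)) else 0) else 0 := by
    intro β m
    by_cases hβ : β = α
    · subst hβ
      simp only [Pi.single_apply, Sum.inr.injEq, Prod.mk.injEq, true_and, mul_ite, mul_one,
        mul_zero, Finset.sum_ite_eq', if_true]
      rw [if_congr (Finset.HasAntidiagonal.mem_antidiagonal.trans eq_comm) rfl rfl]
    · simp [hβ]
  simp only [jetSum, hin]
  simp
  intro h'
  omega

/-- `F` is differentiable in every jet coordinate at `z`, and its derivative at `z` along the vector
field with coefficients `c`, truncated at the order `n`, is `F'`. -/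
def HasJetDeriv (n : ℕ) (c : JetIndex → ℝ) (F : Jet → ℝ) (F' : ℝ) (z : Jet) : Prop :=
  (∀ a, DifferentiableAt ℝ (fun s : ℝ => F (Function.update z a s)) (z a)) ∧
    jetSum n c (fun a => pderiv a F z) = F'

namespace HasJetDeriv

variable {n : ℕ} {c : JetIndex → ℝ} {F G : Jet → ℝ} {F' G' : ℝ} {z : Jet}

theorem of_eq (h : HasJetDeriv n c F F' z) (e : F' = G') : HasJetDeriv n c F G' z := e ▸ h

theorem const (r : ℝ) : HasJetDeriv n c (fun _ => r) 0 z := by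
  refine ⟨fun a => differentiableAt_const _, ?_⟩
  simp only [pderiv, deriv_const]
  exact jetSum_zero n c

theorem add (hF : HasJetDeriv n c F F' z) (hG : HasJetDeriv n c G G' z) :
    HasJetDeriv n c (fun y => F y + G y) (F' + G') z := by
  refine ⟨fun a => (hF.1 a).add (hG.1 a), ?_⟩
  rw [← hF.2, ← hG.2, ← jetSum_add]
  congr 1
  funext a
  exact deriv_fun_add (hF.1 a) (hG.1 a)

theorem mul (hF : HasJetDeriv n c F F' z) (hG : HasJetDeriv n c G G' z) :
    HasJetDeriv n c (fun y => F y * G y) (F' * G z + F z * G') z := by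
  refine ⟨fun a => (hF.1 a).mul (hG.1 a), ?_⟩
  rw [← hF.2, ← hG.2, mul_comm _ (G z), ← jetSum_const_mul, ← jetSum_const_mul, ← jetSum_add]
  congr 1
  funext a
  have := deriv_fun_mul (hF.1 a) (hG.1 a)
  simp only [Function.update_eq_self] at this
  rw [pderiv, this, pderiv, pderiv]
  ring

theorem const_mul (r : ℝ) (hF : HasJetDeriv n c F F' z) :
    HasJetDeriv n c (fun y => r * F y) (r * F') z :=
  ((const r).mul hF).of_eq (by ring)

theorem sub (hF : HasJetDeriv n c F F' z) (hG : HasJetDeriv n c G G' z) :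
    HasJetDeriv n c (fun y => F y - G y) (F' - G') z := by
  have h := hF.add (hG.const_mul (-1))
  have e : (fun y => F y + -1 * G y) = fun y => F y - G y := by
    funext y
    ring
  rw [e] at h
  exact h.of_eq (by ring)

theorem sum {ι : Type*} (s : Finset ι) {F : ι → Jet → ℝ} {F' : ι → ℝ}
    (h : ∀ i, HasJetDeriv n c (F i) (F' i) z) :
    HasJetDeriv n c (fun y => ∑ i ∈ s, F i y) (∑ i ∈ s, F' i) z := by
  classical
  induction s using Finset.induction_on with
  | empty => simpa using const (n := n) (c := c) (z := z) 0
  | insert i s hi ih => simpa only [Finset.sum_insert hi] using (h i).add ih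

theorem pderiv_coord (b a : JetIndex) (z : Jet) :
    pderiv a (fun y => y b) z = (Pi.single b 1 : JetIndex → ℝ) a := by
  by_cases h : a = b
  · subst h
    simp [pderiv]
  · simp [pderiv, Function.update_of_ne (Ne.symm h), h]

theorem differentiableAt_coord (b a : JetIndex) (z : Jet) :
    DifferentiableAt ℝ (fun s : ℝ => (Function.update z a s) b) (z a) := by
  by_cases h : b = a
  · subst h
    simp
  · simp [Function.update_of_ne h]

theorem coord (α : Fin 3) (J : ℕ × ℕ) (h : J.1 + J.2 ≤ n) :
    HasJetDeriv n c (fun y => y (Sum.inr (α, J))) (c (Sum.inr (α, J))) z := by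
  refine ⟨fun a => differentiableAt_coord _ a z, ?_⟩
  simp only [pderiv_coord]
  exact jetSum_single_inr n c α J h

end HasJetDeriv

/-! ### Functions of the base point -/

/-- The partial derivative of a function on the base with respect to the coordinate number `a`,
where `x, t, u, v, w` have the numbers `0, …, 4`. -/
noncomputable def bderiv (a : Fin 5) (f : Base → ℝ) (p : Base) : ℝ :=
  fderiv ℝ f p (Pi.single a 1)

/-- The jet coordinates of order zero, in the order in which they form the base point. -/
def baseIndex : Fin 5 → JetIndex :=
  ![Sum.inl 0, Sum.inl 1, Sum.inr (0, 0, 0), Sum.inr (1, 0, 0), Sum.inr (2, 0, 0)]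

theorem basePoint_apply (z : Jet) (i : Fin 5) : basePoint z i = z (baseIndex i) := by
  fin_cases i <;> rfl

theorem continuous_basePoint_update (z : Jet) (a : JetIndex) :
    Continuous fun s : ℝ => basePoint (Function.update z a s) := by
  refine continuous_pi fun i => ?_
  simp only [basePoint_apply]
  exact (continuous_apply (A := fun _ => ℝ) (baseIndex i)).comp
    (continuous_const.update a continuous_id)

theorem eventually_basePoint_mem {U : Set Base} (hU : IsOpen U) {z : Jet} (hz : basePoint z ∈ U)
    (a : JetIndex) : ∀ᶠ s in nhds (z a), basePoint (Function.update z a s) ∈ U := by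
  refine (continuous_basePoint_update z a).continuousAt.eventually_mem (hU.mem_nhds ?_)
  simpa using hz

/-- The derivative of a function at a jet over the open set `U` depends only on its values at the
jets over `U`. -/
theorem HasJetDeriv.congr {n : ℕ} {c : JetIndex → ℝ} {F G : Jet → ℝ} {F' : ℝ} {z : Jet}
    {U : Set Base} (hU : IsOpen U) (hz : basePoint z ∈ U) (h : ∀ y, basePoint y ∈ U → F y = G y)
    (hG : HasJetDeriv n c G F' z) : HasJetDeriv n c F F' z := by
  have key : ∀ a, (fun s : ℝ => F (Function.update z a s)) =ᶠ[nhds (z a)]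
      fun s : ℝ => G (Function.update z a s) := fun a =>
    (eventually_basePoint_mem hU hz a).mono fun s hs => h _ hs
  refine ⟨fun a => (hG.1 a).congr_of_eventuallyEq (key a), ?_⟩
  rw [← hG.2]
  congr 1
  funext a
  exact (key a).deriv_eq

theorem basePoint_update_baseIndex (z : Jet) (i : Fin 5) (s : ℝ) :
    basePoint (Function.update z (baseIndex i) s) = Function.update (basePoint z) i s := by
  funext j
  rw [basePoint_apply]
  fin_cases i <;> fin_cases j <;> simp [baseIndex, basePoint]

theorem basePoint_update_of_ne (z : Jet) (a : JetIndex) (h : ∀ i, baseIndex i ≠ a) (s : ℝ) :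
    basePoint (Function.update z a s) = basePoint z := by
  funext j
  rw [basePoint_apply, basePoint_apply, Function.update_of_ne (h j)]

theorem hasDerivAt_base {f : Base → ℝ} {z : Jet} (hf : DifferentiableAt ℝ f (basePoint z))
    (i : Fin 5) : HasDerivAt (fun s : ℝ => f (basePoint (Function.update z (baseIndex i) s)))
      (bderiv i f (basePoint z)) (z (baseIndex i)) := by
  simp only [basePoint_update_baseIndex]
  rw [← basePoint_apply z i]
  have h1 := hasDerivAt_update (𝕜 := ℝ) (basePoint z) i (basePoint z i)
  have h2 : HasFDerivAt f (fderiv ℝ f (basePoint z))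
      (Function.update (basePoint z) i (basePoint z i)) := by
    rw [Function.update_eq_self]
    exact hf.hasFDerivAt
  exact h2.comp_hasDerivAt _ h1

theorem HasJetDeriv.base {n : ℕ} {c : JetIndex → ℝ} {f : Base → ℝ} {z : Jet}
    (hf : DifferentiableAt ℝ f (basePoint z)) :
    HasJetDeriv n c (fun y => f (basePoint y))
      (∑ i, c (baseIndex i) * bderiv i f (basePoint z)) z := by
  have hin : ∀ i, pderiv (baseIndex i) (fun y => f (basePoint y)) z = bderiv i f (basePoint z) :=
    fun i => (hasDerivAt_base hf i).deriv
  have hout : ∀ a, (∀ i, baseIndex i ≠ a) → pderiv a (fun y => f (basePoint y)) z = 0 := by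
    intro a ha
    simp [pderiv, basePoint_update_of_ne z a ha]
  have hsum : (fun a => pderiv a (fun y => f (basePoint y)) z) =
      fun a => ∑ i, bderiv i f (basePoint z) * (Pi.single (baseIndex i) 1 : JetIndex → ℝ) a := by
    have hinj : Function.Injective baseIndex := by decide
    funext a
    by_cases ha : ∃ i, baseIndex i = a
    · obtain ⟨i, rfl⟩ := ha
      simp [hin, Pi.single_apply, hinj.eq_iff]
    · push Not at ha
      rw [hout a ha]
      simp [fun i => Ne.symm (ha i)]
  refine ⟨fun a => ?_, ?_⟩
  · by_cases ha : ∃ i, baseIndex i = a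
    · obtain ⟨i, rfl⟩ := ha
      exact (hasDerivAt_base hf i).differentiableAt
    · push Not at ha
      simp [basePoint_update_of_ne z a ha]
  · rw [hsum]
    simp only [Fin.sum_univ_five, jetSum_add, jetSum_const_mul]
    simp only [baseIndex, Matrix.cons_val]
    rw [jetSum_single_inl, jetSum_single_inl, jetSum_single_inr _ _ _ _ (by simp),
      jetSum_single_inr _ _ _ _ (by simp), jetSum_single_inr _ _ _ _ (by simp)]
    ring

/-! ### Total derivatives of functions of the base point -/

/-- The coefficients at the jet `z` of the total derivative `D_k`, a vector field on jet space. -/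
def totalCoeff (k : Fin 2) (z : Jet) : JetIndex → ℝ :=
  Sum.elim (Pi.single k 1) fun β => z (Sum.inr (β.1, bump k β.2))

theorem totalDeriv_eq (n : ℕ) (k : Fin 2) (F : Jet → ℝ) (z : Jet) :
    totalDeriv n k F z = jetSum n (totalCoeff k z) (fun a => pderiv a F z) := by
  fin_cases k <;> simp [totalDeriv, jetSum, totalCoeff]

theorem HasJetDeriv.totalDeriv_eq {n : ℕ} {k : Fin 2} {F : Jet → ℝ} {F' : ℝ} {z : Jet}
    (h : HasJetDeriv n (totalCoeff k z) F F' z) : totalDeriv n k F z = F' :=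
  (KaupBoussinesq.totalDeriv_eq n k F z).trans h.2

/-- `D_t` of a function of the base point. -/
noncomputable def tD1 (f : Base → ℝ) (z : Jet) : ℝ :=
  bderiv 1 f (basePoint z) +
    ∑ α : Fin 3, z (Sum.inr (α, 0, 1)) * bderiv (Fin.natAdd 2 α) f (basePoint z)

/-- `D_x` of a function of the base point. -/
noncomputable def xD1 (f : Base → ℝ) (z : Jet) : ℝ :=
  bderiv 0 f (basePoint z) +
    ∑ α : Fin 3, z (Sum.inr (α, 1, 0)) * bderiv (Fin.natAdd 2 α) f (basePoint z)

/-- `D_x ^ 2` of a function of the base point. -/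
noncomputable def xD2 (f : Base → ℝ) (z : Jet) : ℝ :=
  xD1 (bderiv 0 f) z +
    ∑ α : Fin 3, (z (Sum.inr (α, 2, 0)) * bderiv (Fin.natAdd 2 α) f (basePoint z) +
      z (Sum.inr (α, 1, 0)) * xD1 (bderiv (Fin.natAdd 2 α) f) z)

/-- `D_x ^ 3` of a function of the base point. -/
noncomputable def xD3 (f : Base → ℝ) (z : Jet) : ℝ :=
  xD2 (bderiv 0 f) z +
    ∑ α : Fin 3, (z (Sum.inr (α, 3, 0)) * bderiv (Fin.natAdd 2 α) f (basePoint z) +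
      2 * (z (Sum.inr (α, 2, 0)) * xD1 (bderiv (Fin.natAdd 2 α) f) z) +
      z (Sum.inr (α, 1, 0)) * xD2 (bderiv (Fin.natAdd 2 α) f) z)

section Smooth

variable {U : Set Base} {f : Base → ℝ} {z : Jet} {n : ℕ}

theorem contDiffOn_bderiv (hU : IsOpen U) (hf : ContDiffOn ℝ ∞ f U) (a : Fin 5) :
    ContDiffOn ℝ ∞ (bderiv a f) U :=
  (hf.fderiv_of_isOpen hU (m := ∞) (by simp)).clm_apply contDiffOn_const

theorem differentiableAt_of_contDiffOn (hU : IsOpen U) (hf : ContDiffOn ℝ ∞ f U) {p : Base}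
    (hp : p ∈ U) : DifferentiableAt ℝ f p :=
  (hf.contDiffAt (hU.mem_nhds hp)).differentiableAt (by simp)

theorem hasJetDeriv_base_t (hU : IsOpen U) (hf : ContDiffOn ℝ ∞ f U) (hz : basePoint z ∈ U) :
    HasJetDeriv n (totalCoeff 1 z) (fun y => f (basePoint y)) (tD1 f z) z := by
  refine (HasJetDeriv.base (differentiableAt_of_contDiffOn hU hf hz)).of_eq ?_
  simp only [Fin.sum_univ_five, Fin.sum_univ_three, tD1, baseIndex, totalCoeff, bump]
  simp
  ring!

theorem hasJetDeriv_base_x (hU : IsOpen U) (hf : ContDiffOn ℝ ∞ f U) (hz : basePoint z ∈ U) :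
    HasJetDeriv n (totalCoeff 0 z) (fun y => f (basePoint y)) (xD1 f z) z := by
  refine (HasJetDeriv.base (differentiableAt_of_contDiffOn hU hf hz)).of_eq ?_
  simp only [Fin.sum_univ_five, Fin.sum_univ_three, xD1, baseIndex, totalCoeff, bump]
  simp
  ring!

theorem hasJetDeriv_coord_x (α : Fin 3) (i j : ℕ) (h : i + j ≤ n) :
    HasJetDeriv n (totalCoeff 0 z) (fun y => y (Sum.inr (α, i, j))) (z (Sum.inr (α, i + 1, j))) z :=
  (HasJetDeriv.coord α (i, j) h).of_eq (by simp [totalCoeff, bump])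

theorem hasJetDeriv_coord_t (α : Fin 3) (i j : ℕ) (h : i + j ≤ n) :
    HasJetDeriv n (totalCoeff 1 z) (fun y => y (Sum.inr (α, i, j))) (z (Sum.inr (α, i, j + 1))) z :=
  (HasJetDeriv.coord α (i, j) h).of_eq (by simp [totalCoeff, bump])

theorem hasJetDeriv_xD1 (hU : IsOpen U) (hf : ContDiffOn ℝ ∞ f U) (hz : basePoint z ∈ U)
    (hn : 1 ≤ n) : HasJetDeriv n (totalCoeff 0 z) (xD1 f) (xD2 f z) z := by
  have hb := fun a => hasJetDeriv_base_x (n := n) hU (contDiffOn_bderiv hU hf a) hz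
  exact (hb 0).add (HasJetDeriv.sum _ fun α => (hasJetDeriv_coord_x α 1 0 hn).mul (hb _))

theorem hasJetDeriv_xD2 (hU : IsOpen U) (hf : ContDiffOn ℝ ∞ f U) (hz : basePoint z ∈ U)
    (hn : 2 ≤ n) : HasJetDeriv n (totalCoeff 0 z) (xD2 f) (xD3 f z) z := by
  have hb := fun a => hasJetDeriv_base_x (n := n) hU (contDiffOn_bderiv hU hf a) hz
  have hx := fun a => hasJetDeriv_xD1 (n := n) hU (contDiffOn_bderiv hU hf a) hz (by lia)
  refine ((hx 0).add (HasJetDeriv.sum _ fun α =>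
    ((hasJetDeriv_coord_x α 2 0 hn).mul (hb _)).add
      ((hasJetDeriv_coord_x α 1 0 (by lia)).mul (hx _)))).of_eq ?_
  simp only [xD3]
  congr 1
  refine Finset.sum_congr rfl fun α _ => ?_
  ring!

end Smooth

/-! ### The prolongation of a vector field and the determining equations -/

section Prolong

variable {U : Set Base} {V : Base → Base} {z : Jet}

theorem prolong_eq_of_hasJetDeriv {n : ℕ} {F : Jet → ℝ} {F' : ℝ} {c : JetIndex → ℝ}
    (hc : c = Sum.elim ![V (basePoint z) 0, V (basePoint z) 1]
      fun β => prolongCoeff V β.1 β.2.1 β.2.2 z) (h : HasJetDeriv n c F F' z) :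
    prolong n V F z = F' := by
  rw [← h.2, hc]
  simp [prolong, jetSum]

theorem prolong_system_zero : prolong 3 V (system 0) z =
    prolongCoeff V 0 0 1 z - 3 / 2 * (prolongCoeff V 0 0 0 z * z (Sum.inr (0, 1, 0)) +
      z (Sum.inr (0, 0, 0)) * prolongCoeff V 0 1 0 z) - prolongCoeff V 1 1 0 z := by
  refine prolong_eq_of_hasJetDeriv rfl (HasJetDeriv.of_eq
    (((HasJetDeriv.coord 0 (0, 1) (by simp)).sub
      (((HasJetDeriv.coord 0 (0, 0) (by simp)).const_mul (3 / 2)).mul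
        (HasJetDeriv.coord 0 (1, 0) (by simp)))).sub
      (HasJetDeriv.coord 1 (1, 0) (by simp))) ?_)
  simp only [Sum.elim_inr]
  ring

theorem prolong_system_one : prolong 3 V (system 1) z =
    prolongCoeff V 1 0 1 z - (prolongCoeff V 1 0 0 z * z (Sum.inr (0, 1, 0)) +
      z (Sum.inr (1, 0, 0)) * prolongCoeff V 0 1 0 z) -
      1 / 2 * (prolongCoeff V 0 0 0 z * z (Sum.inr (1, 1, 0)) +
      z (Sum.inr (0, 0, 0)) * prolongCoeff V 1 1 0 z) - prolongCoeff V 2 1 0 z := by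
  refine prolong_eq_of_hasJetDeriv rfl (HasJetDeriv.of_eq
    ((((HasJetDeriv.coord 1 (0, 1) (by simp)).sub
      ((HasJetDeriv.coord 1 (0, 0) (by simp)).mul (HasJetDeriv.coord 0 (1, 0) (by simp)))).sub
      (((HasJetDeriv.coord 0 (0, 0) (by simp)).const_mul (1 / 2)).mul
        (HasJetDeriv.coord 1 (1, 0) (by simp)))).sub
      (HasJetDeriv.coord 2 (1, 0) (by simp))) ?_)
  simp only [Sum.elim_inr]
  ring

theorem prolong_system_two : prolong 3 V (system 2) z =
    prolongCoeff V 2 0 1 z + 1 / 4 * prolongCoeff V 0 3 0 z -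
      (prolongCoeff V 2 0 0 z * z (Sum.inr (0, 1, 0)) +
      z (Sum.inr (2, 0, 0)) * prolongCoeff V 0 1 0 z) -
      1 / 2 * (prolongCoeff V 0 0 0 z * z (Sum.inr (2, 1, 0)) +
      z (Sum.inr (0, 0, 0)) * prolongCoeff V 2 1 0 z) := by
  refine prolong_eq_of_hasJetDeriv rfl (HasJetDeriv.of_eq
    ((((HasJetDeriv.coord 2 (0, 1) (by simp)).add
      ((HasJetDeriv.coord 0 (3, 0) (by simp)).const_mul (1 / 4))).sub
      ((HasJetDeriv.coord 2 (0, 0) (by simp)).mul (HasJetDeriv.coord 0 (1, 0) (by simp)))).sub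
      (((HasJetDeriv.coord 0 (0, 0) (by simp)).const_mul (1 / 2)).mul
        (HasJetDeriv.coord 2 (1, 0) (by simp)))) ?_)
  simp only [Sum.elim_inr]
  ring

/-- The component number `i` of a vector field: `ξ, τ, η₁, η₂, η₃` for `i = 0, …, 4`. -/
def component (V : Base → Base) (i : Fin 5) (p : Base) : ℝ := V p i

theorem contDiffOn_component (hV : ContDiffOn ℝ ∞ V U) (i : Fin 5) :
    ContDiffOn ℝ ∞ (component V i) U :=
  contDiffOn_pi.1 hV i

theorem prolongCoeff_zero_one (hU : IsOpen U) (hV : ContDiffOn ℝ ∞ V U) (hz : basePoint z ∈ U)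
    (α : Fin 3) : prolongCoeff V α 0 1 z =
      tD1 (component V (Fin.natAdd 2 α)) z - tD1 (component V 0) z * z (Sum.inr (α, 1, 0)) -
        tD1 (component V 1) z * z (Sum.inr (α, 0, 1)) := by
  have h : ∀ i, totalDeriv 0 1 (fun y => V (basePoint y) i) z = tD1 (component V i) z :=
    fun i => (hasJetDeriv_base_t (n := 0) hU (contDiffOn_component hV i) hz).totalDeriv_eq
  simp only [prolongCoeff, prolongCoeffT, prolongStep, h, bump]
  rfl

/-- The coefficient of `∂/∂u^α_x` in the prolongation of `V`. -/
noncomputable def coeffX (V : Base → Base) (α : Fin 3) (z : Jet) : ℝ :=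
  xD1 (component V (Fin.natAdd 2 α)) z - xD1 (component V 0) z * z (Sum.inr (α, 1, 0)) -
    xD1 (component V 1) z * z (Sum.inr (α, 0, 1))

/-- The coefficient of `∂/∂u^α_xx` in the prolongation of `V`. -/
noncomputable def coeffXX (V : Base → Base) (α : Fin 3) (z : Jet) : ℝ :=
  xD2 (component V (Fin.natAdd 2 α)) z - xD2 (component V 0) z * z (Sum.inr (α, 1, 0)) -
    xD2 (component V 1) z * z (Sum.inr (α, 0, 1)) -
    2 * (xD1 (component V 0) z * z (Sum.inr (α, 2, 0))) -
    2 * (xD1 (component V 1) z * z (Sum.inr (α, 1, 1)))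

theorem prolongCoeff_one_zero (hU : IsOpen U) (hV : ContDiffOn ℝ ∞ V U) (hz : basePoint z ∈ U)
    (α : Fin 3) : prolongCoeff V α 1 0 z = coeffX V α z := by
  have h : ∀ i, totalDeriv 0 0 (fun y => V (basePoint y) i) z = xD1 (component V i) z :=
    fun i => (hasJetDeriv_base_x (n := 0) hU (contDiffOn_component hV i) hz).totalDeriv_eq
  simp only [prolongCoeff, prolongCoeffT, prolongStep, h, bump]
  rfl

theorem prolongCoeff_two_zero (hU : IsOpen U) (hV : ContDiffOn ℝ ∞ V U) (hz : basePoint z ∈ U)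
    (α : Fin 3) : prolongCoeff V α 2 0 z = coeffXX V α z := by
  have h : ∀ i, totalDeriv 0 0 (fun y => V (basePoint y) i) z = xD1 (component V i) z :=
    fun i => (hasJetDeriv_base_x (n := 0) hU (contDiffOn_component hV i) hz).totalDeriv_eq
  have hx := fun i => hasJetDeriv_xD1 (n := 1) hU (contDiffOn_component hV i) hz le_rfl
  have hc : HasJetDeriv 1 (totalCoeff 0 z) (prolongCoeff V α 1 0) _ z :=
    HasJetDeriv.congr hU hz (fun y hy => prolongCoeff_one_zero hU hV hy α)
      (((hx (Fin.natAdd 2 α)).sub ((hx 0).mul (hasJetDeriv_coord_x α 1 0 le_rfl))).sub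
        ((hx 1).mul (hasJetDeriv_coord_x α 0 1 le_rfl)))
  rw [prolongCoeff, prolongStep, h, h]
  change totalDeriv 1 0 _ z - _ - _ = _
  rw [hc.totalDeriv_eq]
  simp only [coeffXX, bump, if_true, one_ne_zero, if_false]
  ring

theorem prolongCoeff_three_zero (hU : IsOpen U) (hV : ContDiffOn ℝ ∞ V U) (hz : basePoint z ∈ U)
    (α : Fin 3) : prolongCoeff V α 3 0 z =
      xD3 (component V (Fin.natAdd 2 α)) z - xD3 (component V 0) z * z (Sum.inr (α, 1, 0)) -
        xD3 (component V 1) z * z (Sum.inr (α, 0, 1)) -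
        3 * (xD2 (component V 0) z * z (Sum.inr (α, 2, 0))) -
        3 * (xD2 (component V 1) z * z (Sum.inr (α, 1, 1))) -
        3 * (xD1 (component V 0) z * z (Sum.inr (α, 3, 0))) -
        3 * (xD1 (component V 1) z * z (Sum.inr (α, 2, 1))) := by
  have h : ∀ i, totalDeriv 0 0 (fun y => V (basePoint y) i) z = xD1 (component V i) z :=
    fun i => (hasJetDeriv_base_x (n := 0) hU (contDiffOn_component hV i) hz).totalDeriv_eq
  have hx := fun i => hasJetDeriv_xD1 (n := 2) hU (contDiffOn_component hV i) hz (by simp)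
  have hxx := fun i => hasJetDeriv_xD2 (n := 2) hU (contDiffOn_component hV i) hz le_rfl
  have hc : HasJetDeriv 2 (totalCoeff 0 z) (prolongCoeff V α 2 0) _ z :=
    HasJetDeriv.congr hU hz (fun y hy => prolongCoeff_two_zero hU hV hy α)
      (((((hxx (Fin.natAdd 2 α)).sub ((hxx 0).mul (hasJetDeriv_coord_x α 1 0 (by simp)))).sub
        ((hxx 1).mul (hasJetDeriv_coord_x α 0 1 (by simp)))).sub
        (((hx 0).mul (hasJetDeriv_coord_x α 2 0 le_rfl)).const_mul 2)).sub
        (((hx 1).mul (hasJetDeriv_coord_x α 1 1 le_rfl)).const_mul 2))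
  rw [prolongCoeff, prolongStep, h, h]
  change totalDeriv 2 0 _ z - _ - _ = _
  rw [hc.totalDeriv_eq]
  simp only [bump, if_true, one_ne_zero, if_false]
  ring

end Prolong

/-! ### Jets satisfying the system and its differential consequences -/

/-- This and the next nine lemmas list the `D_x ^ i D_t ^ j` of the first two equations for
`0 < i + j ≤ 2`. The third equation has order three itself, so that no derivative of it enters
`prolongedLocus`. -/
theorem system_zero_t : iterTotalDerivT 1 (system 0) 1 = fun z =>
    z (Sum.inr (0, 0, 2))
      - 3 / 2 * (z (Sum.inr (0, 0, 1)) * z (Sum.inr (0, 1, 0)))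
      - 3 / 2 * (z (Sum.inr (0, 0, 0)) * z (Sum.inr (0, 1, 1)))
      - z (Sum.inr (1, 1, 1)) := by
  funext z
  change totalDeriv (1 + 0) 1 (system 0) z = _
  simp only [system, Matrix.cons_val]
  apply HasJetDeriv.totalDeriv_eq
  apply HasJetDeriv.of_eq
  · repeat' first
      | exact hasJetDeriv_coord_t _ _ _ (by simp)
      | apply HasJetDeriv.const_mul
      | apply HasJetDeriv.sub
      | apply HasJetDeriv.add
      | apply HasJetDeriv.mul
  · ring

theorem system_zero_tt : iterTotalDerivT 1 (system 0) 2 = fun z =>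
    z (Sum.inr (0, 0, 3))
      - 3 / 2 * (z (Sum.inr (0, 0, 2)) * z (Sum.inr (0, 1, 0)))
      - 3 * (z (Sum.inr (0, 0, 1)) * z (Sum.inr (0, 1, 1)))
      - 3 / 2 * (z (Sum.inr (0, 0, 0)) * z (Sum.inr (0, 1, 2)))
      - z (Sum.inr (1, 1, 2)) := by
  funext z
  change totalDeriv (1 + 1) 1 (iterTotalDerivT 1 (system 0) 1) z = _
  rw [system_zero_t]
  apply HasJetDeriv.totalDeriv_eq
  apply HasJetDeriv.of_eq
  · repeat' first
      | exact hasJetDeriv_coord_t _ _ _ (by simp)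
      | apply HasJetDeriv.const_mul
      | apply HasJetDeriv.sub
      | apply HasJetDeriv.add
      | apply HasJetDeriv.mul
  · ring

theorem system_zero_x : iterTotalDeriv 1 (system 0) 1 0 = fun z =>
    z (Sum.inr (0, 1, 1))
      - 3 / 2 * (z (Sum.inr (0, 1, 0)) * z (Sum.inr (0, 1, 0)))
      - 3 / 2 * (z (Sum.inr (0, 0, 0)) * z (Sum.inr (0, 2, 0)))
      - z (Sum.inr (1, 2, 0)) := by
  funext z
  change totalDeriv (1 + 0 + 0) 0 (system 0) z = _
  simp only [system, Matrix.cons_val]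
  apply HasJetDeriv.totalDeriv_eq
  apply HasJetDeriv.of_eq
  · repeat' first
      | exact hasJetDeriv_coord_x _ _ _ (by simp)
      | apply HasJetDeriv.const_mul
      | apply HasJetDeriv.sub
      | apply HasJetDeriv.add
      | apply HasJetDeriv.mul
  · ring

theorem system_zero_xx : iterTotalDeriv 1 (system 0) 2 0 = fun z =>
    z (Sum.inr (0, 2, 1))
      - 3 / 2 * (z (Sum.inr (0, 2, 0)) * z (Sum.inr (0, 1, 0)))
      - 3 * (z (Sum.inr (0, 1, 0)) * z (Sum.inr (0, 2, 0)))
      - 3 / 2 * (z (Sum.inr (0, 0, 0)) * z (Sum.inr (0, 3, 0)))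
      - z (Sum.inr (1, 3, 0)) := by
  funext z
  change totalDeriv (1 + 1 + 0) 0 (iterTotalDeriv 1 (system 0) 1 0) z = _
  rw [system_zero_x]
  apply HasJetDeriv.totalDeriv_eq
  apply HasJetDeriv.of_eq
  · repeat' first
      | exact hasJetDeriv_coord_x _ _ _ (by simp)
      | apply HasJetDeriv.const_mul
      | apply HasJetDeriv.sub
      | apply HasJetDeriv.add
      | apply HasJetDeriv.mul
  · ring

theorem system_zero_xt : iterTotalDeriv 1 (system 0) 1 1 = fun z =>
    z (Sum.inr (0, 1, 2))
      - 3 / 2 * (z (Sum.inr (0, 1, 1)) * z (Sum.inr (0, 1, 0)))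
      - 3 / 2 * (z (Sum.inr (0, 0, 1)) * z (Sum.inr (0, 2, 0)))
      - 3 / 2 * (z (Sum.inr (0, 1, 0)) * z (Sum.inr (0, 1, 1)))
      - 3 / 2 * (z (Sum.inr (0, 0, 0)) * z (Sum.inr (0, 2, 1)))
      - z (Sum.inr (1, 2, 1)) := by
  funext z
  change totalDeriv (1 + 0 + 1) 0 (iterTotalDerivT 1 (system 0) 1) z = _
  rw [system_zero_t]
  apply HasJetDeriv.totalDeriv_eq
  apply HasJetDeriv.of_eq
  · repeat' first
      | exact hasJetDeriv_coord_x _ _ _ (by simp)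
      | apply HasJetDeriv.const_mul
      | apply HasJetDeriv.sub
      | apply HasJetDeriv.add
      | apply HasJetDeriv.mul
  · ring

theorem system_one_t : iterTotalDerivT 1 (system 1) 1 = fun z =>
    z (Sum.inr (1, 0, 2))
      - z (Sum.inr (1, 0, 1)) * z (Sum.inr (0, 1, 0))
      - z (Sum.inr (1, 0, 0)) * z (Sum.inr (0, 1, 1))
      - 1 / 2 * (z (Sum.inr (0, 0, 1)) * z (Sum.inr (1, 1, 0)))
      - 1 / 2 * (z (Sum.inr (0, 0, 0)) * z (Sum.inr (1, 1, 1)))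
      - z (Sum.inr (2, 1, 1)) := by
  funext z
  change totalDeriv (1 + 0) 1 (system 1) z = _
  simp only [system, Matrix.cons_val]
  apply HasJetDeriv.totalDeriv_eq
  apply HasJetDeriv.of_eq
  · repeat' first
      | exact hasJetDeriv_coord_t _ _ _ (by simp)
      | apply HasJetDeriv.const_mul
      | apply HasJetDeriv.sub
      | apply HasJetDeriv.add
      | apply HasJetDeriv.mul
  · ring

theorem system_one_tt : iterTotalDerivT 1 (system 1) 2 = fun z =>
    z (Sum.inr (1, 0, 3))
      - z (Sum.inr (1, 0, 2)) * z (Sum.inr (0, 1, 0))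
      - 2 * (z (Sum.inr (1, 0, 1)) * z (Sum.inr (0, 1, 1)))
      - z (Sum.inr (1, 0, 0)) * z (Sum.inr (0, 1, 2))
      - 1 / 2 * (z (Sum.inr (0, 0, 2)) * z (Sum.inr (1, 1, 0)))
      - z (Sum.inr (0, 0, 1)) * z (Sum.inr (1, 1, 1))
      - 1 / 2 * (z (Sum.inr (0, 0, 0)) * z (Sum.inr (1, 1, 2)))
      - z (Sum.inr (2, 1, 2)) := by
  funext z
  change totalDeriv (1 + 1) 1 (iterTotalDerivT 1 (system 1) 1) z = _
  rw [system_one_t]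
  apply HasJetDeriv.totalDeriv_eq
  apply HasJetDeriv.of_eq
  · repeat' first
      | exact hasJetDeriv_coord_t _ _ _ (by simp)
      | apply HasJetDeriv.const_mul
      | apply HasJetDeriv.sub
      | apply HasJetDeriv.add
      | apply HasJetDeriv.mul
  · ring

theorem system_one_x : iterTotalDeriv 1 (system 1) 1 0 = fun z =>
    z (Sum.inr (1, 1, 1))
      - z (Sum.inr (1, 1, 0)) * z (Sum.inr (0, 1, 0))
      - z (Sum.inr (1, 0, 0)) * z (Sum.inr (0, 2, 0))
      - 1 / 2 * (z (Sum.inr (0, 1, 0)) * z (Sum.inr (1, 1, 0)))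
      - 1 / 2 * (z (Sum.inr (0, 0, 0)) * z (Sum.inr (1, 2, 0)))
      - z (Sum.inr (2, 2, 0)) := by
  funext z
  change totalDeriv (1 + 0 + 0) 0 (system 1) z = _
  simp only [system, Matrix.cons_val]
  apply HasJetDeriv.totalDeriv_eq
  apply HasJetDeriv.of_eq
  · repeat' first
      | exact hasJetDeriv_coord_x _ _ _ (by simp)
      | apply HasJetDeriv.const_mul
      | apply HasJetDeriv.sub
      | apply HasJetDeriv.add
      | apply HasJetDeriv.mul
  · ring

theorem system_one_xx : iterTotalDeriv 1 (system 1) 2 0 = fun z =>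
    z (Sum.inr (1, 2, 1))
      - z (Sum.inr (1, 2, 0)) * z (Sum.inr (0, 1, 0))
      - 2 * (z (Sum.inr (1, 1, 0)) * z (Sum.inr (0, 2, 0)))
      - z (Sum.inr (1, 0, 0)) * z (Sum.inr (0, 3, 0))
      - 1 / 2 * (z (Sum.inr (0, 2, 0)) * z (Sum.inr (1, 1, 0)))
      - z (Sum.inr (0, 1, 0)) * z (Sum.inr (1, 2, 0))
      - 1 / 2 * (z (Sum.inr (0, 0, 0)) * z (Sum.inr (1, 3, 0)))
      - z (Sum.inr (2, 3, 0)) := by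
  funext z
  change totalDeriv (1 + 1 + 0) 0 (iterTotalDeriv 1 (system 1) 1 0) z = _
  rw [system_one_x]
  apply HasJetDeriv.totalDeriv_eq
  apply HasJetDeriv.of_eq
  · repeat' first
      | exact hasJetDeriv_coord_x _ _ _ (by simp)
      | apply HasJetDeriv.const_mul
      | apply HasJetDeriv.sub
      | apply HasJetDeriv.add
      | apply HasJetDeriv.mul
  · ring

theorem system_one_xt : iterTotalDeriv 1 (system 1) 1 1 = fun z =>
    z (Sum.inr (1, 1, 2))
      - z (Sum.inr (1, 1, 1)) * z (Sum.inr (0, 1, 0))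
      - z (Sum.inr (1, 0, 1)) * z (Sum.inr (0, 2, 0))
      - z (Sum.inr (1, 1, 0)) * z (Sum.inr (0, 1, 1))
      - z (Sum.inr (1, 0, 0)) * z (Sum.inr (0, 2, 1))
      - 1 / 2 * (z (Sum.inr (0, 1, 1)) * z (Sum.inr (1, 1, 0)))
      - 1 / 2 * (z (Sum.inr (0, 0, 1)) * z (Sum.inr (1, 2, 0)))
      - 1 / 2 * (z (Sum.inr (0, 1, 0)) * z (Sum.inr (1, 1, 1)))
      - 1 / 2 * (z (Sum.inr (0, 0, 0)) * z (Sum.inr (1, 2, 1)))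
      - z (Sum.inr (2, 2, 1)) := by
  funext z
  change totalDeriv (1 + 0 + 1) 0 (iterTotalDerivT 1 (system 1) 1) z = _
  rw [system_one_t]
  apply HasJetDeriv.totalDeriv_eq
  apply HasJetDeriv.of_eq
  · repeat' first
      | exact hasJetDeriv_coord_x _ _ _ (by simp)
      | apply HasJetDeriv.const_mul
      | apply HasJetDeriv.sub
      | apply HasJetDeriv.add
      | apply HasJetDeriv.mul
  · ring

/-- Over every base point there are jets satisfying the system and its differential consequences
with prescribed `u_x, v_x, w_x, u_xx, u_xxx, v_xxx` and with `v_xx = w_xx = w_xxx = 0`: the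
equations can be solved for the derivatives that involve `t`. -/
theorem exists_mem_prolongedLocus (p : Base) (u1 v1 w1 u2 u3 v3 : ℝ) :
    ∃ z ∈ prolongedLocus, basePoint z = p ∧
      (z (Sum.inr (0, 1, 0)) = u1 ∧ z (Sum.inr (1, 1, 0)) = v1 ∧ z (Sum.inr (2, 1, 0)) = w1) ∧
      (z (Sum.inr (0, 2, 0)) = u2 ∧ z (Sum.inr (1, 2, 0)) = 0 ∧ z (Sum.inr (2, 2, 0)) = 0) ∧
      (z (Sum.inr (0, 3, 0)) = u3 ∧ z (Sum.inr (1, 3, 0)) = v3 ∧ z (Sum.inr (2, 3, 0)) = 0) ∧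
      z (Sum.inr (0, 0, 1)) = 3 / 2 * p 2 * u1 + v1 ∧
      z (Sum.inr (1, 0, 1)) = p 3 * u1 + 1 / 2 * p 2 * v1 + w1 ∧
      z (Sum.inr (2, 0, 1)) = -1 / 4 * u3 + p 4 * u1 + 1 / 2 * p 2 * w1 ∧
      z (Sum.inr (0, 1, 1)) = 3 / 2 * (u1 * u1 + p 2 * u2) ∧
      z (Sum.inr (0, 2, 1)) = 3 / 2 * (3 * u1 * u2 + p 2 * u3) + v3 := by
  let ut := 3 / 2 * p 2 * u1 + v1
  let vt := p 3 * u1 + 1 / 2 * p 2 * v1 + w1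
  let wt := -1 / 4 * u3 + p 4 * u1 + 1 / 2 * p 2 * w1
  let uxt := 3 / 2 * (u1 * u1 + p 2 * u2)
  let uxxt := 3 / 2 * (3 * u1 * u2 + p 2 * u3) + v3
  let vxt := v1 * u1 + p 3 * u2 + 1 / 2 * u1 * v1
  let vxxt := 2 * v1 * u2 + p 3 * u3 + 1 / 2 * (u2 * v1 + p 2 * v3)
  let utt := 3 / 2 * (ut * u1 + p 2 * uxt) + vxt
  let vtt := vt * u1 + p 3 * uxt + 1 / 2 * (ut * v1 + p 2 * vxt)
  let uxtt := 3 / 2 * (uxt * u1 + ut * u2 + u1 * uxt + p 2 * uxxt) + vxxt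
  let vxtt := vxt * u1 + vt * u2 + v1 * uxt + p 3 * uxxt +
    1 / 2 * (uxt * v1 + u1 * vxt + p 2 * vxxt)
  let uttt := 3 / 2 * (utt * u1 + 2 * ut * uxt + p 2 * uxtt) + vxtt
  let vttt := vtt * u1 + 2 * vt * uxt + p 3 * uxtt + 1 / 2 * (utt * v1 + 2 * ut * vxt + p 2 * vxtt)
  let f : Fin 3 → ℕ → ℕ → ℝ := ![
    fun i j => match i, j with
      | 0, 0 => p 2 | 1, 0 => u1 | 2, 0 => u2 | 3, 0 => u3 | 0, 1 => ut | 1, 1 => uxt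
      | 2, 1 => uxxt | 0, 2 => utt | 1, 2 => uxtt | 0, 3 => uttt | _, _ => 0,
    fun i j => match i, j with
      | 0, 0 => p 3 | 1, 0 => v1 | 3, 0 => v3 | 0, 1 => vt | 1, 1 => vxt
      | 2, 1 => vxxt | 0, 2 => vtt | 1, 2 => vxtt | 0, 3 => vttt | _, _ => 0,
    fun i j => match i, j with
      | 0, 0 => p 4 | 1, 0 => w1 | 0, 1 => wt | _, _ => 0]
  let z : Jet := Sum.elim ![p 0, p 1] fun β => f β.1 β.2.1 β.2.2
  refine ⟨z, ?_, ?_, ⟨rfl, rfl, rfl⟩, ⟨rfl, rfl, rfl⟩, ⟨rfl, rfl, rfl⟩, rfl, rfl, rfl, rfl, rfl⟩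
  · intro k i j h
    have hk : k = 0 ∨ k = 1 ∨ k = 2 := by fin_cases k <;> simp
    obtain rfl | rfl | rfl := hk
    · have hij : i + j ≤ 2 := by simp [systemOrder] at h; lia
      have hcases : (i = 0 ∧ j = 0) ∨ (i = 0 ∧ j = 1) ∨ (i = 0 ∧ j = 2) ∨ (i = 1 ∧ j = 0) ∨
        (i = 1 ∧ j = 1) ∨ (i = 2 ∧ j = 0) := by lia
      obtain ⟨rfl, rfl⟩ | ⟨rfl, rfl⟩ | ⟨rfl, rfl⟩ | ⟨rfl, rfl⟩ | ⟨rfl, rfl⟩ | ⟨rfl, rfl⟩ := hcases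
      · change ut - 3 / 2 * p 2 * u1 - v1 = 0
        ring
      · change iterTotalDerivT 1 (system 0) 1 z = 0
        rw [system_zero_t]
        change utt - 3 / 2 * (ut * u1) - 3 / 2 * (p 2 * uxt) - vxt = 0
        ring
      · change iterTotalDerivT 1 (system 0) 2 z = 0
        rw [system_zero_tt]
        change uttt - 3 / 2 * (utt * u1) - 3 * (ut * uxt) - 3 / 2 * (p 2 * uxtt) - vxtt = 0
        ring
      · change iterTotalDeriv 1 (system 0) 1 0 z = 0
        rw [system_zero_x]
        change uxt - 3 / 2 * (u1 * u1) - 3 / 2 * (p 2 * u2) - 0 = 0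
        ring
      · change iterTotalDeriv 1 (system 0) 1 1 z = 0
        rw [system_zero_xt]
        change uxtt - 3 / 2 * (uxt * u1) - 3 / 2 * (ut * u2) - 3 / 2 * (u1 * uxt)
          - 3 / 2 * (p 2 * uxxt) - vxxt = 0
        ring
      · change iterTotalDeriv 1 (system 0) 2 0 z = 0
        rw [system_zero_xx]
        change uxxt - 3 / 2 * (u2 * u1) - 3 * (u1 * u2) - 3 / 2 * (p 2 * u3) - v3 = 0
        ring
    · have hij : i + j ≤ 2 := by simp [systemOrder] at h; lia
      have hcases : (i = 0 ∧ j = 0) ∨ (i = 0 ∧ j = 1) ∨ (i = 0 ∧ j = 2) ∨ (i = 1 ∧ j = 0) ∨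
        (i = 1 ∧ j = 1) ∨ (i = 2 ∧ j = 0) := by lia
      obtain ⟨rfl, rfl⟩ | ⟨rfl, rfl⟩ | ⟨rfl, rfl⟩ | ⟨rfl, rfl⟩ | ⟨rfl, rfl⟩ | ⟨rfl, rfl⟩ := hcases
      · change vt - p 3 * u1 - 1 / 2 * p 2 * v1 - w1 = 0
        ring
      · change iterTotalDerivT 1 (system 1) 1 z = 0
        rw [system_one_t]
        change vtt - vt * u1 - p 3 * uxt - 1 / 2 * (ut * v1) - 1 / 2 * (p 2 * vxt) - 0 = 0
        ring
      · change iterTotalDerivT 1 (system 1) 2 z = 0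
        rw [system_one_tt]
        change vttt - vtt * u1 - 2 * (vt * uxt) - p 3 * uxtt - 1 / 2 * (utt * v1) - ut * vxt
          - 1 / 2 * (p 2 * vxtt) - 0 = 0
        ring
      · change iterTotalDeriv 1 (system 1) 1 0 z = 0
        rw [system_one_x]
        change vxt - v1 * u1 - p 3 * u2 - 1 / 2 * (u1 * v1) - 1 / 2 * (p 2 * 0) - 0 = 0
        ring
      · change iterTotalDeriv 1 (system 1) 1 1 z = 0
        rw [system_one_xt]
        change vxtt - vxt * u1 - vt * u2 - v1 * uxt - p 3 * uxxt - 1 / 2 * (uxt * v1)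
          - 1 / 2 * (ut * 0) - 1 / 2 * (u1 * vxt) - 1 / 2 * (p 2 * vxxt) - 0 = 0
        ring
      · change iterTotalDeriv 1 (system 1) 2 0 z = 0
        rw [system_one_xx]
        change vxxt - 0 * u1 - 2 * (v1 * u2) - p 3 * u3 - 1 / 2 * (u2 * v1) - u1 * 0
          - 1 / 2 * (p 2 * v3) - 0 = 0
        ring
    · have hij : i = 0 ∧ j = 0 := by simp [systemOrder] at h; lia
      obtain ⟨rfl, rfl⟩ := hij
      change wt + 1 / 4 * u3 - p 4 * u1 - 1 / 2 * p 2 * w1 = 0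
      ring
  · funext i
    fin_cases i <;> rfl

/-! ### Partial derivatives on an open set of the base -/

section Bderiv

variable {U : Set Base} {f g : Base → ℝ} {p : Base}

theorem bderiv_congr (hU : IsOpen U) (h : ∀ q ∈ U, f q = g q) (hp : p ∈ U) (a : Fin 5) :
    bderiv a f p = bderiv a g p := by
  have h' : f =ᶠ[nhds p] g := Filter.eventuallyEq_of_mem (hU.mem_nhds hp) h
  rw [bderiv, bderiv, h'.fderiv_eq]

theorem bderiv_const (a : Fin 5) (r : ℝ) (p : Base) : bderiv a (fun _ => r) p = 0 := by
  simp [bderiv]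

theorem bderiv_eq_zero (hU : IsOpen U) (h : ∀ q ∈ U, f q = 0) (hp : p ∈ U) (a : Fin 5) :
    bderiv a f p = 0 :=
  (bderiv_congr hU h hp a).trans (bderiv_const a 0 p)

theorem bderiv_add (hf : DifferentiableAt ℝ f p) (hg : DifferentiableAt ℝ g p) (a : Fin 5) :
    bderiv a (fun q => f q + g q) p = bderiv a f p + bderiv a g p := by
  simp [bderiv, fderiv_fun_add hf hg]

theorem bderiv_const_mul (hf : DifferentiableAt ℝ f p) (r : ℝ) (a : Fin 5) :
    bderiv a (fun q => r * f q) p = r * bderiv a f p := by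
  simp [bderiv, fderiv_const_mul hf]

theorem bderiv_mul (hf : DifferentiableAt ℝ f p) (hg : DifferentiableAt ℝ g p) (a : Fin 5) :
    bderiv a (fun q => f q * g q) p = f p * bderiv a g p + g p * bderiv a f p := by
  simp [bderiv, fderiv_fun_mul hf hg]

theorem differentiableAt_coord (i : Fin 5) (p : Base) :
    DifferentiableAt ℝ (fun q : Base => q i) p := by
  fun_prop

theorem bderiv_coord (a i : Fin 5) (p : Base) :
    bderiv a (fun q => q i) p = (Pi.single a 1 : Base) i := by
  have h : HasFDerivAt (fun q : Base => q i) (ContinuousLinearMap.proj (R := ℝ) i) p :=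
    (ContinuousLinearMap.proj (R := ℝ) (φ := fun _ : Fin 5 => ℝ) i).hasFDerivAt
  rw [bderiv, h.fderiv]
  rfl

theorem bderiv_comm (hU : IsOpen U) (hf : ContDiffOn ℝ ∞ f U) (hp : p ∈ U) (a b : Fin 5) :
    bderiv a (bderiv b f) p = bderiv b (bderiv a f) p := by
  have hc := hf.contDiffAt (hU.mem_nhds hp)
  have hs : IsSymmSndFDerivAt ℝ f p := hc.isSymmSndFDerivAt
    (by simpa using WithTop.coe_le_coe.2 (le_top : (2 : ℕ∞) ≤ ⊤))
  have hd : DifferentiableAt ℝ (fderiv ℝ f) p :=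
    (hc.fderiv_right (m := 1) (by norm_cast)).differentiableAt (by simp)
  have key : ∀ a b, bderiv a (bderiv b f) p =
      fderiv ℝ (fderiv ℝ f) p (Pi.single a 1) (Pi.single b 1) := by
    intro a b
    have h := hd.hasFDerivAt.clm_apply (hasFDerivAt_const (Pi.single b 1 : Base) p)
    have e : bderiv b f = fun q => fderiv ℝ f q (Pi.single b 1) := rfl
    rw [bderiv, e, h.fderiv]
    simp
  rw [key, key, hs.eq]

/-- A function on a connected open set with vanishing partial derivatives is constant. -/
theorem exists_eq_const_of_bderiv (hU : IsOpen U) (hc : IsPreconnected U)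
    (hf : ContDiffOn ℝ ∞ f U) (h : ∀ p ∈ U, ∀ a, bderiv a f p = 0) :
    ∃ r, ∀ p ∈ U, f p = r := by
  refine hU.exists_is_const_of_fderiv_eq_zero (𝕜 := ℝ) hc (hf.differentiableOn (by simp)) ?_
  intro p hp
  refine ContinuousLinearMap.coe_injective (LinearMap.pi_ext' fun a => ?_)
  refine LinearMap.ext_ring ?_
  simpa [bderiv] using h p hp a

/-- `f` has on `U` only a partial derivative with respect to `t`. -/
def TimeOnly (U : Set Base) (f : Base → ℝ) : Prop :=
  ∀ p ∈ U, ∀ a, a ≠ 1 → bderiv a f p = 0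

/-- The partial derivatives of `f` on `U` in the directions `x, u, v, w` depend only on `t`. -/
def SpatiallyAffine (U : Set Base) (f : Base → ℝ) : Prop :=
  ∀ a, a ≠ 1 → TimeOnly U (bderiv a f)

theorem TimeOnly.congr (hU : IsOpen U) (h : ∀ q ∈ U, f q = g q) (hg : TimeOnly U g) :
    TimeOnly U f :=
  fun p hp a ha => (bderiv_congr hU h hp a).trans (hg p hp a ha)

theorem timeOnly_of_eq_zero (hU : IsOpen U) (h : ∀ q ∈ U, f q = 0) : TimeOnly U f :=
  fun _ hp a _ => bderiv_eq_zero hU h hp a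

theorem timeOnly_of_eq_const (hU : IsOpen U) {r : ℝ} (h : ∀ q ∈ U, f q = r) : TimeOnly U f :=
  fun p hp a _ => (bderiv_congr hU h hp a).trans (bderiv_const a r p)

theorem TimeOnly.const_mul (hU : IsOpen U) (hfc : ContDiffOn ℝ ∞ f U) (hf : TimeOnly U f) (r : ℝ) :
    TimeOnly U (fun q => r * f q) := fun p hp a ha => by
  rw [bderiv_const_mul (differentiableAt_of_contDiffOn hU hfc hp), hf p hp a ha, mul_zero]

theorem TimeOnly.bderiv (hU : IsOpen U) (hfc : ContDiffOn ℝ ∞ f U) (hf : TimeOnly U f)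
    (b : Fin 5) : TimeOnly U (bderiv b f) := fun p hp a ha => by
  rw [bderiv_comm hU hfc hp]
  exact bderiv_eq_zero hU (fun q hq => hf q hq a ha) hp b

theorem TimeOnly.xD1_eq (hf : TimeOnly U f) {z : Jet} (hz : basePoint z ∈ U) : xD1 f z = 0 := by
  have h0 := hf _ hz 0 (by decide)
  have h : ∀ α : Fin 3, KaupBoussinesq.bderiv (Fin.natAdd 2 α) f (basePoint z) = 0 :=
    fun α => hf _ hz _ (by revert α; decide)
  simp [xD1, h0, h]

theorem TimeOnly.xD2_eq (hU : IsOpen U) (hf : TimeOnly U f) {z : Jet} (hz : basePoint z ∈ U) :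
    xD2 f z = 0 := by
  have hb : ∀ a, a ≠ 1 → xD1 (KaupBoussinesq.bderiv a f) z = 0 := fun a ha =>
    (timeOnly_of_eq_zero hU fun q hq => hf q hq a ha).xD1_eq hz
  have h : ∀ α : Fin 3, KaupBoussinesq.bderiv (Fin.natAdd 2 α) f (basePoint z) = 0 :=
    fun α => hf _ hz _ (by revert α; decide)
  have h' : ∀ α : Fin 3, xD1 (KaupBoussinesq.bderiv (Fin.natAdd 2 α) f) z = 0 :=
    fun α => hb _ (by revert α; decide)
  simp [xD2, hb 0 (by decide), h, h']

theorem SpatiallyAffine.xD2_eq (hf : SpatiallyAffine U f) {z : Jet} (hz : basePoint z ∈ U) :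
    xD2 f z = z (Sum.inr (0, 2, 0)) * bderiv 2 f (basePoint z) +
      z (Sum.inr (1, 2, 0)) * bderiv 3 f (basePoint z) +
      z (Sum.inr (2, 2, 0)) * bderiv 4 f (basePoint z) := by
  have h' : ∀ α : Fin 3, xD1 (bderiv (Fin.natAdd 2 α) f) z = 0 :=
    fun α => (hf _ (by revert α; decide)).xD1_eq hz
  simp only [xD2, (hf 0 (by decide)).xD1_eq hz, h', mul_zero, add_zero, zero_add,
    Fin.sum_univ_three]
  rfl

theorem SpatiallyAffine.xD3_eq (hU : IsOpen U) (hf : SpatiallyAffine U f) {z : Jet}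
    (hz : basePoint z ∈ U) :
    xD3 f z = z (Sum.inr (0, 3, 0)) * bderiv 2 f (basePoint z) +
      z (Sum.inr (1, 3, 0)) * bderiv 3 f (basePoint z) +
      z (Sum.inr (2, 3, 0)) * bderiv 4 f (basePoint z) := by
  have h1 : ∀ α : Fin 3, xD1 (bderiv (Fin.natAdd 2 α) f) z = 0 :=
    fun α => (hf _ (by revert α; decide)).xD1_eq hz
  have h2 : ∀ α : Fin 3, xD2 (bderiv (Fin.natAdd 2 α) f) z = 0 :=
    fun α => (hf _ (by revert α; decide)).xD2_eq hU hz
  simp only [xD3, (hf 0 (by decide)).xD2_eq hU hz, h1, h2, mul_zero, add_zero, zero_add,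
    Fin.sum_univ_three]
  rfl

end Bderiv

/-! ### The determining equations -/

section Determining

variable {U : Set Base} {V : Base → Base} {z : Jet}

theorem prolong_system_zero_eq (hU : IsOpen U) (hV : ContDiffOn ℝ ∞ V U) (hz : basePoint z ∈ U) :
    prolong 3 V (system 0) z =
      (tD1 (component V 2) z - tD1 (component V 0) z * z (Sum.inr (0, 1, 0)) -
        tD1 (component V 1) z * z (Sum.inr (0, 0, 1))) -
      3 / 2 * (component V 2 (basePoint z) * z (Sum.inr (0, 1, 0)) + basePoint z 2 *
        (xD1 (component V 2) z - xD1 (component V 0) z * z (Sum.inr (0, 1, 0)) -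
          xD1 (component V 1) z * z (Sum.inr (0, 0, 1)))) -
      (xD1 (component V 3) z - xD1 (component V 0) z * z (Sum.inr (1, 1, 0)) -
        xD1 (component V 1) z * z (Sum.inr (1, 0, 1))) := by
  rw [prolong_system_zero, prolongCoeff_zero_one hU hV hz, prolongCoeff_one_zero hU hV hz,
    prolongCoeff_one_zero hU hV hz]
  rfl

theorem prolong_system_one_eq (hU : IsOpen U) (hV : ContDiffOn ℝ ∞ V U) (hz : basePoint z ∈ U) :
    prolong 3 V (system 1) z =
      (tD1 (component V 3) z - tD1 (component V 0) z * z (Sum.inr (1, 1, 0)) -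
        tD1 (component V 1) z * z (Sum.inr (1, 0, 1))) -
      (component V 3 (basePoint z) * z (Sum.inr (0, 1, 0)) + basePoint z 3 *
        (xD1 (component V 2) z - xD1 (component V 0) z * z (Sum.inr (0, 1, 0)) -
          xD1 (component V 1) z * z (Sum.inr (0, 0, 1)))) -
      1 / 2 * (component V 2 (basePoint z) * z (Sum.inr (1, 1, 0)) + basePoint z 2 *
        (xD1 (component V 3) z - xD1 (component V 0) z * z (Sum.inr (1, 1, 0)) -
          xD1 (component V 1) z * z (Sum.inr (1, 0, 1)))) -
      (xD1 (component V 4) z - xD1 (component V 0) z * z (Sum.inr (2, 1, 0)) -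
        xD1 (component V 1) z * z (Sum.inr (2, 0, 1))) := by
  rw [prolong_system_one, prolongCoeff_zero_one hU hV hz, prolongCoeff_one_zero hU hV hz,
    prolongCoeff_one_zero hU hV hz, prolongCoeff_one_zero hU hV hz]
  rfl

theorem prolong_system_two_eq (hU : IsOpen U) (hV : ContDiffOn ℝ ∞ V U) (hz : basePoint z ∈ U) :
    prolong 3 V (system 2) z =
      (tD1 (component V 4) z - tD1 (component V 0) z * z (Sum.inr (2, 1, 0)) -
        tD1 (component V 1) z * z (Sum.inr (2, 0, 1))) +
      1 / 4 * (xD3 (component V 2) z - xD3 (component V 0) z * z (Sum.inr (0, 1, 0)) -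
        xD3 (component V 1) z * z (Sum.inr (0, 0, 1)) -
        3 * (xD2 (component V 0) z * z (Sum.inr (0, 2, 0))) -
        3 * (xD2 (component V 1) z * z (Sum.inr (0, 1, 1))) -
        3 * (xD1 (component V 0) z * z (Sum.inr (0, 3, 0))) -
        3 * (xD1 (component V 1) z * z (Sum.inr (0, 2, 1)))) -
      (component V 4 (basePoint z) * z (Sum.inr (0, 1, 0)) + basePoint z 4 *
        (xD1 (component V 2) z - xD1 (component V 0) z * z (Sum.inr (0, 1, 0)) -
          xD1 (component V 1) z * z (Sum.inr (0, 0, 1)))) -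
      1 / 2 * (component V 2 (basePoint z) * z (Sum.inr (2, 1, 0)) + basePoint z 2 *
        (xD1 (component V 4) z - xD1 (component V 0) z * z (Sum.inr (2, 1, 0)) -
          xD1 (component V 1) z * z (Sum.inr (2, 0, 1)))) := by
  rw [prolong_system_two, prolongCoeff_zero_one hU hV hz, prolongCoeff_one_zero hU hV hz,
    prolongCoeff_one_zero hU hV hz, prolongCoeff_three_zero hU hV hz]
  rfl

theorem xD1_eq (f : Base → ℝ) (z : Jet) : xD1 f z = bderiv 0 f (basePoint z) +
    (z (Sum.inr (0, 1, 0)) * bderiv 2 f (basePoint z) +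
      z (Sum.inr (1, 1, 0)) * bderiv 3 f (basePoint z) +
      z (Sum.inr (2, 1, 0)) * bderiv 4 f (basePoint z)) := by
  rw [xD1, Fin.sum_univ_three]
  rfl

theorem tD1_eq (f : Base → ℝ) (z : Jet) : tD1 f z = bderiv 1 f (basePoint z) +
    (z (Sum.inr (0, 0, 1)) * bderiv 2 f (basePoint z) +
      z (Sum.inr (1, 0, 1)) * bderiv 3 f (basePoint z) +
      z (Sum.inr (2, 0, 1)) * bderiv 4 f (basePoint z)) := by
  rw [tD1, Fin.sum_univ_three]
  rfl

theorem xD2_eq (f : Base → ℝ) (z : Jet) : xD2 f z = xD1 (bderiv 0 f) z +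
    ((z (Sum.inr (0, 2, 0)) * bderiv 2 f (basePoint z) +
      z (Sum.inr (0, 1, 0)) * xD1 (bderiv 2 f) z) +
    (z (Sum.inr (1, 2, 0)) * bderiv 3 f (basePoint z) +
      z (Sum.inr (1, 1, 0)) * xD1 (bderiv 3 f) z) +
    (z (Sum.inr (2, 2, 0)) * bderiv 4 f (basePoint z) +
      z (Sum.inr (2, 1, 0)) * xD1 (bderiv 4 f) z)) := by
  rw [xD2, Fin.sum_univ_three]
  rfl

theorem xD3_eq (f : Base → ℝ) (z : Jet) : xD3 f z = xD2 (bderiv 0 f) z +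
    ((z (Sum.inr (0, 3, 0)) * bderiv 2 f (basePoint z) +
      2 * (z (Sum.inr (0, 2, 0)) * xD1 (bderiv 2 f) z) +
      z (Sum.inr (0, 1, 0)) * xD2 (bderiv 2 f) z) +
    (z (Sum.inr (1, 3, 0)) * bderiv 3 f (basePoint z) +
      2 * (z (Sum.inr (1, 2, 0)) * xD1 (bderiv 3 f) z) +
      z (Sum.inr (1, 1, 0)) * xD2 (bderiv 3 f) z) +
    (z (Sum.inr (2, 3, 0)) * bderiv 4 f (basePoint z) +
      2 * (z (Sum.inr (2, 2, 0)) * xD1 (bderiv 4 f) z) +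
      z (Sum.inr (2, 1, 0)) * xD2 (bderiv 4 f) z)) := by
  rw [xD3, Fin.sum_univ_three]
  rfl

end Determining

/-! ### Solving the determining equations: the first two equations -/

section Necessity

variable {U : Set Base} {V : Base → Base} {p : Base}

/-- `D_k f` (`k = 0` for `x`, `k = 1` for `t`, as for the base coordinates) of a function of the
base point, as an expression in the derivatives `a, b, c` of `u, v, w` with respect to the same
variable. -/
noncomputable def along (k : Fin 5) (f : Base → ℝ) (p : Base) (a b c : ℝ) : ℝ :=
  bderiv k f p + (a * bderiv 2 f p + b * bderiv 3 f p + c * bderiv 4 f p)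

/-- The first determining equation. Since `u_xxx` is free, so is the value `wt` of `w_t`. -/
theorem determining_zero (hU : IsOpen U) (hV : ContDiffOn ℝ ∞ V U)
    (hS : PreservesSystemOn prolongedLocus U V) (hp : p ∈ U) (u1 v1 w1 wt : ℝ) :
    (along 1 (component V 2) p (3 / 2 * p 2 * u1 + v1) (p 3 * u1 + 1 / 2 * p 2 * v1 + w1) wt -
        along 1 (component V 0) p (3 / 2 * p 2 * u1 + v1) (p 3 * u1 + 1 / 2 * p 2 * v1 + w1) wt
          * u1 -
        along 1 (component V 1) p (3 / 2 * p 2 * u1 + v1) (p 3 * u1 + 1 / 2 * p 2 * v1 + w1) wt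
          * (3 / 2 * p 2 * u1 + v1)) -
      3 / 2 * (component V 2 p * u1 + p 2 * (along 0 (component V 2) p u1 v1 w1 -
        along 0 (component V 0) p u1 v1 w1 * u1 -
        along 0 (component V 1) p u1 v1 w1 * (3 / 2 * p 2 * u1 + v1))) -
      (along 0 (component V 3) p u1 v1 w1 - along 0 (component V 0) p u1 v1 w1 * v1 -
        along 0 (component V 1) p u1 v1 w1 * (p 3 * u1 + 1 / 2 * p 2 * v1 + w1)) = 0 := by
  obtain ⟨z, hz, rfl, ⟨h1, h2, h3⟩, -, -, h4, h5, h6, -, -⟩ :=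
    exists_mem_prolongedLocus p u1 v1 w1 0 (-4 * (wt - (p 4 * u1 + 1 / 2 * p 2 * w1))) 0
  have h := hS z hz hp 0
  have h6' : z (Sum.inr (2, 0, 1)) = wt := by rw [h6]; ring
  rw [prolong_system_zero_eq hU hV hp] at h
  simp only [xD1_eq, tD1_eq, h1, h2, h3, h4, h5, h6'] at h
  exact h

/-- The second determining equation. -/
theorem determining_one (hU : IsOpen U) (hV : ContDiffOn ℝ ∞ V U)
    (hS : PreservesSystemOn prolongedLocus U V) (hp : p ∈ U) (u1 v1 w1 wt : ℝ) :
    (along 1 (component V 3) p (3 / 2 * p 2 * u1 + v1) (p 3 * u1 + 1 / 2 * p 2 * v1 + w1) wt -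
        along 1 (component V 0) p (3 / 2 * p 2 * u1 + v1) (p 3 * u1 + 1 / 2 * p 2 * v1 + w1) wt
          * v1 -
        along 1 (component V 1) p (3 / 2 * p 2 * u1 + v1) (p 3 * u1 + 1 / 2 * p 2 * v1 + w1) wt
          * (p 3 * u1 + 1 / 2 * p 2 * v1 + w1)) -
      (component V 3 p * u1 + p 3 * (along 0 (component V 2) p u1 v1 w1 -
        along 0 (component V 0) p u1 v1 w1 * u1 -
        along 0 (component V 1) p u1 v1 w1 * (3 / 2 * p 2 * u1 + v1))) -
      1 / 2 * (component V 2 p * v1 + p 2 * (along 0 (component V 3) p u1 v1 w1 -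
        along 0 (component V 0) p u1 v1 w1 * v1 -
        along 0 (component V 1) p u1 v1 w1 * (p 3 * u1 + 1 / 2 * p 2 * v1 + w1))) -
      (along 0 (component V 4) p u1 v1 w1 - along 0 (component V 0) p u1 v1 w1 * w1 -
        along 0 (component V 1) p u1 v1 w1 * wt) = 0 := by
  obtain ⟨z, hz, rfl, ⟨h1, h2, h3⟩, -, -, h4, h5, h6, -, -⟩ :=
    exists_mem_prolongedLocus p u1 v1 w1 0 (-4 * (wt - (p 4 * u1 + 1 / 2 * p 2 * w1))) 0
  have h := hS z hz hp 1
  have h6' : z (Sum.inr (2, 0, 1)) = wt := by rw [h6]; ring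
  rw [prolong_system_one_eq hU hV hp] at h
  simp only [xD1_eq, tD1_eq, h1, h2, h3, h4, h5, h6'] at h
  exact h

/-- The coefficients of the first two determining equations that involve `w_t` and `w_x`. -/
theorem first_order_conditions (hU : IsOpen U) (hV : ContDiffOn ℝ ∞ V U)
    (hS : PreservesSystemOn prolongedLocus U V) (hp : p ∈ U) :
    (bderiv 3 (component V 0) p = 0 ∧ bderiv 4 (component V 0) p = 0) ∧
    (bderiv 2 (component V 1) p = 0 ∧ bderiv 3 (component V 1) p = 0 ∧
      bderiv 4 (component V 1) p = 0) ∧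
    bderiv 3 (component V 2) p = -2 * bderiv 0 (component V 1) p ∧
    bderiv 4 (component V 2) p = 0 ∧
    bderiv 4 (component V 3) p = -bderiv 0 (component V 1) p := by
  have e1 := determining_zero hU hV hS hp
  have e2 := determining_one hU hV hS hp
  simp only [along] at e1 e2
  have hA4 : bderiv 4 (component V 2) p = 0 := by
    linear_combination e1 0 0 0 1 - e1 0 0 0 0
  simp only [hA4] at e1
  have hT4 : bderiv 4 (component V 1) p = 0 := by
    linear_combination e1 0 1 0 0 - e1 0 1 0 1
  simp only [hT4] at e1 e2
  have hX4 : bderiv 4 (component V 0) p = 0 := by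
    linear_combination e1 1 0 0 0 - e1 1 0 0 1
  simp only [hX4] at e1 e2
  have hB4 : bderiv 4 (component V 3) p = -bderiv 0 (component V 1) p := by
    linear_combination e2 0 0 0 1 - e2 0 0 0 0
  simp only [hB4] at e1 e2
  have hT2 : bderiv 2 (component V 1) p = 0 := by
    linear_combination e2 1 0 0 1 - e2 1 0 0 0
  have hT3 : bderiv 3 (component V 1) p = 0 := by
    linear_combination e2 0 1 0 1 - e2 0 1 0 0
  simp only [hT2, hT3] at e1
  have hA3 : bderiv 3 (component V 2) p = -2 * bderiv 0 (component V 1) p := by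
    linear_combination e1 0 0 1 0 - e1 0 0 0 0
  simp only [hA3] at e1
  have hX3 : bderiv 3 (component V 0) p = 0 := by
    linear_combination e1 1 0 0 0 - e1 1 0 1 0
  exact ⟨⟨hX3, hX4⟩, ⟨hT2, hT3, hT4⟩, hA3, hA4, hB4⟩

end Necessity

/-! ### Solving the determining equations: the third equation -/

section Necessity

variable {U : Set Base} {V : Base → Base} {p : Base}

/-- `τ` depends only on `t`: the last step compares the coefficients of `v_xxx` in the third
determining equation, where `u_xxt` contributes `v_xxx`. -/
theorem timeOnly_tau (hU : IsOpen U) (hV : ContDiffOn ℝ ∞ V U)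
    (hS : PreservesSystemOn prolongedLocus U V) : TimeOnly U (component V 1) := by
  have hF := fun {q} (hq : q ∈ U) => first_order_conditions hU hV hS hq
  intro p hp a ha
  obtain ⟨⟨hX3, hX4⟩, ⟨hT2, hT3, hT4⟩, hA3, hA4, hB4⟩ := hF hp
  obtain rfl | rfl | rfl | rfl : a = 0 ∨ a = 2 ∨ a = 3 ∨ a = 4 := by
    revert a; decide
  · -- Among the `x`-derivatives of `u, v, w`, the jets `z` and `y` differ only in `v_xxx`.
    obtain ⟨z, hz, rfl, ⟨h1, h2, h3⟩, ⟨h4, h5, h6⟩, ⟨h7, h8, h9⟩, h10, h11, h12, h13, h14⟩ :=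
      exists_mem_prolongedLocus p 0 0 0 0 0 1
    obtain ⟨y, hy, hyz, ⟨k1, k2, k3⟩, ⟨k4, k5, k6⟩, ⟨k7, k8, k9⟩, k10, k11, k12, k13, k14⟩ :=
      exists_mem_prolongedLocus (basePoint z) 0 0 0 0 0 0
    have e := hS z hz hp 2
    have e' := hS y hy (hyz ▸ hp) 2
    rw [prolong_system_two_eq hU hV hp] at e
    rw [prolong_system_two_eq hU hV (hyz ▸ hp)] at e'
    simp only [tD1_eq, xD1_eq, xD2_eq, xD3_eq, hyz, h1, h2, h3, h4, h5, h6, h7, h8, h9, h10, h11,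
      h12, h13, h14, k1, k2, k3, k4, k5, k6, k7, k8, k9, k10, k11, k12, k13, k14] at e e'
    linear_combination -4 / 5 * (e - e') + 1 / 5 * hA3
  · exact hT2
  · exact hT3
  · exact hT4

/-- `ξ_u = 0`, from the coefficient of `u_xx ^ 2` in the third determining equation. -/
theorem bderiv_two_xi (hU : IsOpen U) (hV : ContDiffOn ℝ ∞ V U)
    (hS : PreservesSystemOn prolongedLocus U V) (hp : p ∈ U) : bderiv 2 (component V 0) p = 0 := by
  have hT := timeOnly_tau hU hV hS
  have hcV := contDiffOn_component hV
  have hTa : SpatiallyAffine U (component V 1) := fun a _ => hT.bderiv hU (hcV 1) a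
  -- At jets whose only nonzero `x`-derivative is `u_xx = s`, the third determining equation is
  -- quadratic in `s`.
  have key : ∀ s : ℝ, ∃ r : ℝ, r = bderiv 1 (component V 4) p +
      1 / 4 * (bderiv 0 (bderiv 0 (bderiv 0 (component V 2))) p +
        s * (bderiv 2 (bderiv 0 (component V 2)) p + 2 * bderiv 0 (bderiv 2 (component V 2)) p) -
        3 * s * (bderiv 0 (bderiv 0 (component V 0)) p + s * bderiv 2 (component V 0) p)) -
      p 4 * bderiv 0 (component V 2) p - 1 / 2 * p 2 * bderiv 0 (component V 4) p ∧ r = 0 := by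
    intro s
    refine ⟨_, rfl, ?_⟩
    obtain ⟨z, hz, rfl, ⟨h1, h2, h3⟩, ⟨h4, h5, h6⟩, ⟨h7, h8, h9⟩, h10, h11, h12, h13, h14⟩ :=
      exists_mem_prolongedLocus p 0 0 0 s 0 0
    have e := hS z hz hp 2
    rw [prolong_system_two_eq hU hV hp, hT.xD1_eq hp, hT.xD2_eq hU hp, hTa.xD3_eq hU hp] at e
    simp only [tD1_eq, xD1_eq, xD2_eq, xD3_eq, h1, h2, h3, h4, h5, h6, h7, h8, h9, h10, h11,
      h12] at e
    linear_combination e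
  obtain ⟨_, rfl, e0⟩ := key 0
  obtain ⟨_, rfl, e1⟩ := key 1
  obtain ⟨_, rfl, e2⟩ := key (-1)
  linear_combination -2 / 3 * (e1 + e2 - 2 * e0)

/-- The comparison of the coefficients of `w_x` in the second, of `v_x` in the first and of `u_xxx`
in the third determining equation. -/
theorem bderiv_zero_xi (hU : IsOpen U) (hV : ContDiffOn ℝ ∞ V U)
    (hS : PreservesSystemOn prolongedLocus U V) (hp : p ∈ U) :
    bderiv 0 (component V 0) p = 3 / 5 * bderiv 1 (component V 1) p ∧
    bderiv 3 (component V 3) p = bderiv 2 (component V 2) p - bderiv 1 (component V 1) p +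
      bderiv 0 (component V 0) p ∧
    bderiv 4 (component V 4) p = bderiv 2 (component V 2) p - 2 * bderiv 1 (component V 1) p +
      2 * bderiv 0 (component V 0) p := by
  have hT := timeOnly_tau hU hV hS
  have hT0 := hT _ hp 0 (by decide)
  have hX2 := bderiv_two_xi hU hV hS hp
  obtain ⟨⟨hX3, hX4⟩, ⟨hT2, hT3, hT4⟩, hA3, hA4, hB4⟩ := first_order_conditions hU hV hS hp
  have e1 := determining_zero hU hV hS hp
  have e2 := determining_one hU hV hS hp
  simp only [along, hT0, hT2, hT3, hT4, hX2, hX3, hX4, hA3, hA4, hB4] at e1 e2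
  have hB3 : bderiv 3 (component V 3) p = bderiv 2 (component V 2) p - bderiv 1 (component V 1) p +
      bderiv 0 (component V 0) p := by
    linear_combination e1 0 0 0 0 - e1 0 1 0 0
  have hC4 : bderiv 4 (component V 4) p = bderiv 3 (component V 3) p -
      bderiv 1 (component V 1) p + bderiv 0 (component V 0) p := by
    linear_combination e2 0 0 0 0 - e2 0 0 1 0
  refine ⟨?_, hB3, by rw [hC4, hB3]; ring⟩
  -- Among the `x`-derivatives of `u, v, w`, the jets `z` and `y` differ only in `u_xxx`.
  obtain ⟨z, hz, rfl, ⟨h1, h2, h3⟩, ⟨h4, h5, h6⟩, ⟨h7, h8, h9⟩, h10, h11, h12, -, -⟩ :=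
    exists_mem_prolongedLocus p 0 0 0 0 1 0
  obtain ⟨y, hy, hyz, ⟨k1, k2, k3⟩, ⟨k4, k5, k6⟩, ⟨k7, k8, k9⟩, k10, k11, k12, -, -⟩ :=
    exists_mem_prolongedLocus (basePoint z) 0 0 0 0 0 0
  have e := hS z hz hp 2
  have e' := hS y hy (hyz ▸ hp) 2
  rw [prolong_system_two_eq hU hV hp, hT.xD1_eq hp, hT.xD2_eq hU hp] at e
  rw [prolong_system_two_eq hU hV (hyz ▸ hp), hT.xD1_eq (hyz ▸ hp), hT.xD2_eq hU (hyz ▸ hp)] at e'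
  simp only [tD1_eq, xD1_eq, xD2_eq, xD3_eq, hyz, h1, h2, h3, h4, h5, h6, h7, h8, h9, h10, h11,
    h12, k1, k2, k3, k4, k5, k6, k7, k8, k9, k10, k11, k12, hT2, hT3, hT4] at e e'
  linear_combination -4 / 5 * (e - e') - 1 / 5 * (hC4 + hB3)

/-- `ξ` is affine in the spatial variables, with coefficients depending on `t`. -/
theorem spatiallyAffine_xi (hU : IsOpen U) (hV : ContDiffOn ℝ ∞ V U)
    (hS : PreservesSystemOn prolongedLocus U V) : SpatiallyAffine U (component V 0) := by
  intro a ha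
  have hcT := contDiffOn_component hV 1
  obtain rfl | rfl | rfl | rfl : a = 0 ∨ a = 2 ∨ a = 3 ∨ a = 4 := by
    revert a; decide
  · exact (((timeOnly_tau hU hV hS).bderiv hU hcT 1).const_mul hU (contDiffOn_bderiv hU hcT 1)
      (3 / 5)).congr hU fun q hq => (bderiv_zero_xi hU hV hS hq).1
  · exact timeOnly_of_eq_zero hU fun q hq => bderiv_two_xi hU hV hS hq
  · exact timeOnly_of_eq_zero hU fun q hq => (first_order_conditions hU hV hS hq).1.1
  · exact timeOnly_of_eq_zero hU fun q hq => (first_order_conditions hU hV hS hq).1.2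

/-- The third determining equation, simplified by what is known about `ξ` and `τ`. -/
theorem determining_two (hU : IsOpen U) (hV : ContDiffOn ℝ ∞ V U)
    (hS : PreservesSystemOn prolongedLocus U V) (hp : p ∈ U) (u1 v1 w1 : ℝ) :
    ∃ z, basePoint z = p ∧
      (z (Sum.inr (0, 1, 0)) = u1 ∧ z (Sum.inr (1, 1, 0)) = v1 ∧ z (Sum.inr (2, 1, 0)) = w1) ∧
      (z (Sum.inr (0, 2, 0)) = 0 ∧ z (Sum.inr (1, 2, 0)) = 0 ∧ z (Sum.inr (2, 2, 0)) = 0) ∧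
      (z (Sum.inr (0, 3, 0)) = 0 ∧ z (Sum.inr (1, 3, 0)) = 0 ∧ z (Sum.inr (2, 3, 0)) = 0) ∧
    (along 1 (component V 4) p (3 / 2 * p 2 * u1 + v1) (p 3 * u1 + 1 / 2 * p 2 * v1 + w1)
          (p 4 * u1 + 1 / 2 * p 2 * w1) - bderiv 1 (component V 0) p * w1 -
        bderiv 1 (component V 1) p * (p 4 * u1 + 1 / 2 * p 2 * w1)) +
      1 / 4 * xD3 (component V 2) z -
      (component V 4 p * u1 + p 4 * (along 0 (component V 2) p u1 v1 w1 -
        bderiv 0 (component V 0) p * u1)) -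
      1 / 2 * (component V 2 p * w1 + p 2 * (along 0 (component V 4) p u1 v1 w1 -
        bderiv 0 (component V 0) p * w1)) = 0 := by
  have hT := timeOnly_tau hU hV hS
  have hX := spatiallyAffine_xi hU hV hS
  have hTa : SpatiallyAffine U (component V 1) :=
    fun a _ => hT.bderiv hU (contDiffOn_component hV 1) a
  obtain ⟨z, hz, rfl, ⟨h1, h2, h3⟩, ⟨h4, h5, h6⟩, ⟨h7, h8, h9⟩, h10, h11, h12, -, -⟩ :=
    exists_mem_prolongedLocus p u1 v1 w1 0 0 0
  refine ⟨z, rfl, ⟨h1, h2, h3⟩, ⟨h4, h5, h6⟩, ⟨h7, h8, h9⟩, ?_⟩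
  have e := hS z hz hp 2
  obtain ⟨⟨hX3, hX4⟩, ⟨hT2, hT3, hT4⟩, -⟩ := first_order_conditions hU hV hS hp
  have hX2 := bderiv_two_xi hU hV hS hp
  rw [prolong_system_two_eq hU hV hp, hT.xD1_eq hp, hT.xD2_eq hU hp, hTa.xD3_eq hU hp,
    hX.xD2_eq hp, hX.xD3_eq hU hp] at e
  simp only [tD1_eq, xD1_eq, h1, h2, h3, h4, h5, h6, h7, h8, h9, h10, h11, h12, hT2, hT3, hT4,
    hX2, hX3, hX4] at e
  simp only [along]
  linear_combination e

/-- `η₁ = -6/5 ξ_t - 2/5 u τ_t`. The coefficients of `u_x` in the first and of `v_x` in the second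
equation express `∂_v η₃` through `η₁`, and so does the coefficient of `w_x` in the third; comparing
the two expressions determines `η₁`, and with it `∂_u η₂` and `∂_v η₃`. -/
theorem eta_one_conditions (hU : IsOpen U) (hV : ContDiffOn ℝ ∞ V U)
    (hS : PreservesSystemOn prolongedLocus U V) (hp : p ∈ U) :
    component V 2 p = -6 / 5 * bderiv 1 (component V 0) p +
      -2 / 5 * (p 2 * bderiv 1 (component V 1) p) ∧
    bderiv 2 (component V 3) p = 4 / 5 * bderiv 1 (component V 0) p ∧
    bderiv 3 (component V 4) p = 2 / 5 * bderiv 1 (component V 0) p := by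
  have hT := timeOnly_tau hU hV hS
  have hT0 := fun {q} (hq : q ∈ U) => hT q hq 0 (by decide)
  have hF := fun {q} (hq : q ∈ U) => first_order_conditions hU hV hS hq
  have hcA := contDiffOn_component hV 2
  obtain ⟨⟨hX3, hX4⟩, ⟨hT2, hT3, hT4⟩, hA3, hA4, hB4⟩ := hF hp
  have hX2 := bderiv_two_xi hU hV hS hp
  obtain ⟨hX0, hB3, hC4⟩ := bderiv_zero_xi hU hV hS hp
  have e1 := determining_zero hU hV hS hp
  have e2 := determining_one hU hV hS hp
  simp only [along, hT0 hp, hT2, hT3, hT4, hX2, hX3, hX4, hA3, hA4, hB4] at e1 e2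
  have hB2 : bderiv 2 (component V 3) p = -bderiv 1 (component V 0) p
      - 3 / 2 * component V 2 p
      - 3 / 2 * p 2 * (bderiv 1 (component V 1) p - bderiv 0 (component V 0) p) := by
    linear_combination e1 0 0 0 0 - e1 1 0 0 0
  have hC3 : bderiv 3 (component V 4) p = bderiv 2 (component V 3) p - bderiv 1 (component V 0) p
      - 1 / 2 * component V 2 p
      - 1 / 2 * p 2 * (bderiv 1 (component V 1) p - bderiv 0 (component V 0) p) := by
    linear_combination e2 0 0 0 0 - e2 0 1 0 0
  obtain ⟨z, rfl, ⟨h1, h2, h3⟩, ⟨h4, h5, h6⟩, ⟨h7, h8, h9⟩, e⟩ := determining_two hU hV hS hp 0 0 1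
  obtain ⟨y, hyz, ⟨k1, k2, k3⟩, ⟨k4, k5, k6⟩, ⟨k7, k8, k9⟩, e'⟩ :=
    determining_two hU hV hS hp 0 0 0
  -- `η₁` does not depend on `w`, hence neither do its derivatives.
  have hA4' : ∀ q ∈ U, bderiv 4 (component V 2) q = 0 := fun q hq => (hF hq).2.2.2.1
  have hA04 : ∀ q ∈ U, bderiv 4 (bderiv 0 (component V 2)) q = 0 := fun q hq =>
    (bderiv_comm hU hcA hq 4 0).trans (bderiv_eq_zero hU hA4' hq 0)
  have hA004 : bderiv 4 (bderiv 0 (bderiv 0 (component V 2))) (basePoint z) = 0 :=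
    (bderiv_comm hU (contDiffOn_bderiv hU hcA 0) hp 4 0).trans (bderiv_eq_zero hU hA04 hp 0)
  have hxy : xD3 (component V 2) z = xD3 (component V 2) y := by
    have hz := bderiv_eq_zero hU hA4' hp
    simp only [xD3_eq, xD2_eq, xD1_eq, hyz, h1, h2, h3, h4, h5, h6, h7, h8, h9, k1, k2, k3, k4, k5,
      k6, k7, k8, k9, hA004, hA04 _ hp, hz, bderiv_eq_zero hU hA04 hp,
      bderiv_eq_zero hU (fun q hq => bderiv_eq_zero hU hA4' hq 4) hp,
      bderiv_eq_zero hU (fun q hq => bderiv_eq_zero hU hA4' hq 0) hp]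
    ring
  rw [hxy] at e
  simp only [along, hA3, hA4, hT0 hp] at e e'
  have hC3' : bderiv 3 (component V 4) (basePoint z) = bderiv 1 (component V 0) (basePoint z)
      + 1 / 2 * component V 2 (basePoint z)
      + 1 / 2 * basePoint z 2 * (bderiv 1 (component V 1) (basePoint z) -
        bderiv 0 (component V 0) (basePoint z)) := by
    linear_combination e - e'
  have hA : component V 2 (basePoint z) = -6 / 5 * bderiv 1 (component V 0) (basePoint z) +
      -2 / 5 * (basePoint z 2 * bderiv 1 (component V 1) (basePoint z)) := by
    linear_combination 2 / 5 * (hC3 - hC3' + hB2) + basePoint z 2 * hX0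
  refine ⟨hA, ?_, ?_⟩
  · rw [hB2, hA, hX0]
    ring
  · rw [hC3', hA, hX0]
    ring

end Necessity

/-! ### Solving the determining equations: integration -/

section Necessity

variable {U : Set Base} {V : Base → Base} {p : Base}

/-- Mixed second derivatives of `ξ` and `τ`. -/
theorem second_derivatives (hU : IsOpen U) (hV : ContDiffOn ℝ ∞ V U)
    (hS : PreservesSystemOn prolongedLocus U V) (hp : p ∈ U) :
    bderiv 0 (bderiv 1 (component V 0)) p = 3 / 5 * bderiv 1 (bderiv 1 (component V 1)) p ∧
    ∀ a, a ≠ 0 → a ≠ 1 → bderiv a (bderiv 1 (component V 0)) p = 0 := by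
  have hcX := contDiffOn_component hV 0
  have hcT1 := contDiffOn_bderiv hU (contDiffOn_component hV 1) 1
  constructor
  · rw [bderiv_comm hU hcX hp,
      bderiv_congr hU (fun q hq => (bderiv_zero_xi hU hV hS hq).1) hp,
      bderiv_const_mul (differentiableAt_of_contDiffOn hU hcT1 hp)]
  · intro a h0 h1
    rw [bderiv_comm hU hcX hp]
    obtain rfl | rfl | rfl : a = 2 ∨ a = 3 ∨ a = 4 := by
      revert a; decide
    · exact bderiv_eq_zero hU (fun q hq => bderiv_two_xi hU hV hS hq) hp 1
    · exact bderiv_eq_zero hU (fun q hq => (first_order_conditions hU hV hS hq).1.1) hp 1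
    · exact bderiv_eq_zero hU (fun q hq => (first_order_conditions hU hV hS hq).1.2) hp 1

theorem bderiv_eta_one (hU : IsOpen U) (hV : ContDiffOn ℝ ∞ V U)
    (hS : PreservesSystemOn prolongedLocus U V) (hp : p ∈ U) :
    bderiv 0 (component V 2) p = -18 / 25 * bderiv 1 (bderiv 1 (component V 1)) p ∧
    bderiv 1 (component V 2) p = -6 / 5 * bderiv 1 (bderiv 1 (component V 0)) p +
      -2 / 5 * (p 2 * bderiv 1 (bderiv 1 (component V 1)) p) ∧
    bderiv 2 (component V 2) p = -2 / 5 * bderiv 1 (component V 1) p := by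
  have hdX := differentiableAt_of_contDiffOn hU
    (contDiffOn_bderiv hU (contDiffOn_component hV 0) 1) hp
  have hcT1 := contDiffOn_bderiv hU (contDiffOn_component hV 1) 1
  have hdT := differentiableAt_of_contDiffOn hU hcT1 hp
  have hT1 := (timeOnly_tau hU hV hS).bderiv hU (contDiffOn_component hV 1) 1
  have hdu := differentiableAt_coord 2 p
  have hudT : DifferentiableAt ℝ (fun q => q 2 * bderiv 1 (component V 1) q) p := hdu.mul hdT
  have key : ∀ a, bderiv a (component V 2) p =
      -6 / 5 * bderiv a (bderiv 1 (component V 0)) p +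
      -2 / 5 * (p 2 * bderiv a (bderiv 1 (component V 1)) p +
        bderiv 1 (component V 1) p * (Pi.single a 1 : Base) 2) := by
    intro a
    rw [bderiv_congr hU (fun q hq => (eta_one_conditions hU hV hS hq).1) hp,
      bderiv_add (hdX.const_mul _) (hudT.const_mul _), bderiv_const_mul hdX,
      bderiv_const_mul hudT, bderiv_mul hdu hdT, bderiv_coord]
  obtain ⟨hX01, hX⟩ := second_derivatives hU hV hS hp
  refine ⟨?_, ?_, ?_⟩
  · rw [key, hX01, hT1 _ hp 0 (by decide)]
    simp
    ring
  · rw [key]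
    simp
  · rw [key, hX 2 (by decide) (by decide), hT1 _ hp 2 (by decide)]
    simp

/-- Since `η₁` is affine in the spatial variables, `D_x ^ 3 η₁` involves only third derivatives. -/
theorem spatiallyAffine_eta_one (hU : IsOpen U) (hV : ContDiffOn ℝ ∞ V U)
    (hS : PreservesSystemOn prolongedLocus U V) : SpatiallyAffine U (component V 2) := by
  intro a ha
  have hT := timeOnly_tau hU hV hS
  have hcT := contDiffOn_component hV 1
  have hcT1 := contDiffOn_bderiv hU hcT 1
  have hcT11 := contDiffOn_bderiv hU hcT1 1
  have hT1 := hT.bderiv hU hcT 1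
  obtain rfl | rfl | rfl | rfl : a = 0 ∨ a = 2 ∨ a = 3 ∨ a = 4 := by
    revert a; decide
  · exact ((hT1.bderiv hU hcT1 1).const_mul hU hcT11 _).congr hU
      fun q hq => (bderiv_eta_one hU hV hS hq).1
  · exact (hT1.const_mul hU hcT1 _).congr hU fun q hq => (bderiv_eta_one hU hV hS hq).2.2
  · refine timeOnly_of_eq_zero hU fun q hq => ?_
    rw [(first_order_conditions hU hV hS hq).2.2.1, hT q hq 0 (by decide), mul_zero]
  · exact timeOnly_of_eq_zero hU fun q hq => (first_order_conditions hU hV hS hq).2.2.2.1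

/-- `η₂` and `η₃` are read off the coefficients of `u_x` in the second and third equation. -/
theorem eta_two_three (hU : IsOpen U) (hV : ContDiffOn ℝ ∞ V U)
    (hS : PreservesSystemOn prolongedLocus U V) (hp : p ∈ U) :
    component V 3 p = 4 / 5 * (p 2 * bderiv 1 (component V 0) p) +
      -4 / 5 * (p 3 * bderiv 1 (component V 1) p) ∧
    component V 4 p = 2 / 5 * (p 3 * bderiv 1 (component V 0) p) +
      -6 / 5 * (p 4 * bderiv 1 (component V 1) p) := by
  have hT := timeOnly_tau hU hV hS
  have hA := spatiallyAffine_eta_one hU hV hS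
  have hT0 := hT p hp 0 (by decide)
  obtain ⟨⟨hX3, hX4⟩, ⟨hT2, hT3, hT4⟩, hA3, hA4, hB4⟩ := first_order_conditions hU hV hS hp
  have hX2 := bderiv_two_xi hU hV hS hp
  obtain ⟨hX0, hB3, hC4⟩ := bderiv_zero_xi hU hV hS hp
  obtain ⟨-, hB2, hC3⟩ := eta_one_conditions hU hV hS hp
  obtain ⟨hA0, hA1, hA2⟩ := bderiv_eta_one hU hV hS hp
  have e2 := determining_one hU hV hS hp
  rw [hA2, hX0] at hB3 hC4
  simp only [along, hT0, hT2, hT3, hT4, hX0, hX2, hX3, hX4, hA2, hA3, hA4, hB2, hB3, hB4, hC3]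
    at e2
  have e3 : ∀ u1 v1 : ℝ,
      along 1 (component V 4) p (3 / 2 * p 2 * u1 + v1) (p 3 * u1 + 1 / 2 * p 2 * v1) (p 4 * u1) -
        bderiv 1 (component V 1) p * (p 4 * u1) -
        (component V 4 p * u1 + p 4 * (along 0 (component V 2) p u1 v1 0 -
          bderiv 0 (component V 0) p * u1)) -
        1 / 2 * (p 2 * along 0 (component V 4) p u1 v1 0) = 0 := fun u1 v1 => by
    obtain ⟨z, rfl, ⟨h1, h2, h3⟩, -, ⟨h7, h8, h9⟩, e⟩ := determining_two hU hV hS hp u1 v1 0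
    rw [hA.xD3_eq hU hp] at e
    simp only [along, h7, h8, h9] at e ⊢
    linear_combination e
  simp only [along, hA2, hA3, hA4, hC3, hC4, hX0, hT0] at e3
  have hC2 : bderiv 2 (component V 4) p = 0 := by
    linear_combination e3 0 1 - e3 0 0
  constructor
  · linear_combination e2 0 0 0 0 - e2 1 0 0 0 - hC2
  · linear_combination e3 0 0 - e3 1 0 + p 2 * hC2

/-- `τ_tt = 0` and `ξ_tt = 0`: the part of the first determining equation without derivatives of
`u, v, w` is `ξ_tt = u τ_tt / 6`, and the `u`-derivative of this relation is `τ_tt = 0`. -/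
theorem second_time_derivatives (hU : IsOpen U) (hV : ContDiffOn ℝ ∞ V U)
    (hS : PreservesSystemOn prolongedLocus U V) (hp : p ∈ U) :
    bderiv 1 (bderiv 1 (component V 1)) p = 0 ∧ bderiv 1 (bderiv 1 (component V 0)) p = 0 := by
  have hT := timeOnly_tau hU hV hS
  have hcT1 := contDiffOn_bderiv hU (contDiffOn_component hV 1) 1
  have hcX1 := contDiffOn_bderiv hU (contDiffOn_component hV 0) 1
  have hT1 := hT.bderiv hU (contDiffOn_component hV 1) 1
  have key : ∀ q ∈ U, bderiv 1 (bderiv 1 (component V 0)) q =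
      1 / 6 * (q 2 * bderiv 1 (bderiv 1 (component V 1)) q) := by
    intro q hq
    obtain ⟨hA0, hA1, -⟩ := bderiv_eta_one hU hV hS hq
    have hdu := differentiableAt_coord 2 q
    have hdv := differentiableAt_coord 3 q
    have hdX := differentiableAt_of_contDiffOn hU hcX1 hq
    have hdT := differentiableAt_of_contDiffOn hU hcT1 hq
    have huX : DifferentiableAt ℝ (fun q => q 2 * bderiv 1 (component V 0) q) q := hdu.mul hdX
    have hvT : DifferentiableAt ℝ (fun q => q 3 * bderiv 1 (component V 1) q) q := hdv.mul hdT
    have hB0 : bderiv 0 (component V 3) q =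
        12 / 25 * (q 2 * bderiv 1 (bderiv 1 (component V 1)) q) := by
      rw [bderiv_congr hU (fun r hr => (eta_two_three hU hV hS hr).1) hq,
        bderiv_add (huX.const_mul _) (hvT.const_mul _),
        bderiv_const_mul huX, bderiv_const_mul hvT, bderiv_mul hdu hdX,
        bderiv_mul hdv hdT, bderiv_coord, bderiv_coord, (second_derivatives hU hV hS hq).1,
        hT1 q hq 0 (by decide)]
      simp
      ring
    have e1 := determining_zero hU hV hS hq 0 0 0 0
    simp only [along, hA0, hA1, hB0, hT q hq 0 (by decide)] at e1
    linear_combination -5 / 6 * e1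
  have hT11 : bderiv 1 (bderiv 1 (component V 1)) p = 0 := by
    have hdu := differentiableAt_coord 2 p
    have hdT := differentiableAt_of_contDiffOn hU (contDiffOn_bderiv hU hcT1 1) hp
    have hudT : DifferentiableAt ℝ (fun q => q 2 * bderiv 1 (bderiv 1 (component V 1)) q) p :=
      hdu.mul hdT
    have h := bderiv_congr hU key hp 2
    rw [bderiv_const_mul hudT, bderiv_mul hdu hdT, bderiv_coord,
      hT1.bderiv hU hcT1 1 p hp 2 (by decide), bderiv_comm hU hcX1 hp,
      bderiv_eq_zero hU (fun q hq => (second_derivatives hU hV hS hq).2 2 (by decide) (by decide))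
        hp] at h
    simp at h
    exact h
  exact ⟨hT11, by rw [key p hp, hT11]; ring⟩

/-- Every point symmetry is one of the known infinitesimals. -/
theorem exists_eq_infinitesimals (hU : IsOpen U) (hc : IsPreconnected U) (hV : ContDiffOn ℝ ∞ V U)
    (hS : PreservesSystemOn prolongedLocus U V) :
    ∃ c₁ c₂ c₃ c₄ : ℝ, ∀ p ∈ U, V p = infinitesimals c₁ c₂ c₃ c₄ p := by
  have hT := timeOnly_tau hU hV hS
  have hcT := contDiffOn_component hV 1
  have hcX := contDiffOn_component hV 0
  have hcT1 := contDiffOn_bderiv hU hcT 1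
  have hcX1 := contDiffOn_bderiv hU hcX 1
  have hT1 := hT.bderiv hU hcT 1
  have hcoord : ∀ i : Fin 5, ContDiffOn ℝ ∞ (fun q : Base => q i) U := fun i => by fun_prop
  obtain ⟨c₁, hc₁⟩ := exists_eq_const_of_bderiv hU hc hcT1 fun p hp a => by
    by_cases ha : a = 1
    · exact ha ▸ (second_time_derivatives hU hV hS hp).1
    · exact hT1 p hp a ha
  obtain ⟨d, hd⟩ := exists_eq_const_of_bderiv hU hc hcX1 fun p hp a => by
    obtain ⟨h0, h⟩ := second_derivatives hU hV hS hp
    obtain ⟨hT11, hX11⟩ := second_time_derivatives hU hV hS hp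
    by_cases ha : a = 1
    · exact ha ▸ hX11
    by_cases ha' : a = 0
    · rw [ha', h0, hT11, mul_zero]
    · exact h a ha' ha
  obtain ⟨c₂, hc₂⟩ := exists_eq_const_of_bderiv (f := fun q => component V 1 q + -c₁ * q 1) hU hc
    (hcT.add (contDiffOn_const.mul (hcoord 1))) fun p hp a => by
    rw [bderiv_add (differentiableAt_of_contDiffOn hU hcT hp)
      ((differentiableAt_coord 1 p).const_mul _), bderiv_const_mul (differentiableAt_coord 1 p),
      bderiv_coord]
    by_cases ha : a = 1
    · rw [ha, hc₁ p hp]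
      simp
    · rw [hT p hp a ha, Pi.single_eq_of_ne (Ne.symm ha)]
      simp
  obtain ⟨c₄, hc₄⟩ := exists_eq_const_of_bderiv
    (f := fun q => component V 0 q + (-d * q 1 + -(3 * c₁ / 5) * q 0)) hU hc
    (hcX.add ((contDiffOn_const.mul (hcoord 1)).add (contDiffOn_const.mul (hcoord 0))))
    fun p hp a => by
    have h1 := differentiableAt_coord 1 p
    have h0 := differentiableAt_coord 0 p
    have h10 : DifferentiableAt ℝ (fun q : Base => -d * q 1 + -(3 * c₁ / 5) * q 0) p :=
      (h1.const_mul _).add (h0.const_mul _)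
    rw [bderiv_add (differentiableAt_of_contDiffOn hU hcX hp) h10,
      bderiv_add (h1.const_mul _) (h0.const_mul _),
      bderiv_const_mul h1, bderiv_const_mul h0, bderiv_coord, bderiv_coord]
    obtain rfl | rfl | rfl | rfl | rfl : a = 0 ∨ a = 1 ∨ a = 2 ∨ a = 3 ∨ a = 4 := by
      revert a; decide
    · rw [(bderiv_zero_xi hU hV hS hp).1, hc₁ p hp]
      simp
      ring
    · rw [hd p hp]
      simp
    · simp [bderiv_two_xi hU hV hS hp]
    · simp [(first_order_conditions hU hV hS hp).1.1]
    · simp [(first_order_conditions hU hV hS hp).1.2]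
  -- `d` is the value of `ξ_t`, which is `-(5 / 6) c₃`.
  refine ⟨c₁, c₂, -(6 / 5) * d, c₄, fun p hp => ?_⟩
  obtain ⟨hη₂, hη₃⟩ := eta_two_three hU hV hS hp
  have hη₁ := (eta_one_conditions hU hV hS hp).1
  rw [hc₁ p hp, hd p hp] at hη₁ hη₂ hη₃
  have hξ := hc₄ p hp
  have hτ := hc₂ p hp
  simp only [component] at hη₁ hη₂ hη₃ hξ hτ
  funext i
  fin_cases i
  · change V p 0 = -(5 * (-(6 / 5) * d) / 6) * p 1 + 3 * c₁ / 5 * p 0 + c₄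
    linear_combination hξ
  · change V p 1 = c₁ * p 1 + c₂
    linear_combination hτ
  · change V p 2 = -(2 * c₁ / 5) * p 2 + -(6 / 5) * d
    linear_combination hη₁
  · change V p 3 = -(4 * c₁ / 5) * p 3 - 2 * (-(6 / 5) * d) / 3 * p 2
    linear_combination hη₂
  · change V p 4 = -(-(6 / 5) * d / 3) * p 3 - 6 * c₁ / 5 * p 4
    linear_combination hη₃

end Necessity

/-! ### The known infinitesimals are point symmetries -/

section Sufficiency

variable {U : Set Base} {f : Base → ℝ}

theorem bderiv_of_affine (hU : IsOpen U) {r : ℝ} {l : Fin 5 → ℝ}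
    (h : ∀ q ∈ U, f q = r + ∑ i, l i * q i) {p : Base} (hp : p ∈ U) (a : Fin 5) :
    bderiv a f p = l a := by
  rw [bderiv_congr hU h hp]
  have h1 : ∀ i ∈ Finset.univ, HasFDerivAt (fun q : Base => l i * q i)
      (l i • ContinuousLinearMap.proj (R := ℝ) (φ := fun _ : Fin 5 => ℝ) i) p := fun i _ =>
    ((ContinuousLinearMap.proj (R := ℝ) (φ := fun _ : Fin 5 => ℝ) i).hasFDerivAt).const_mul (l i)
  have h2 := (HasFDerivAt.fun_sum h1).const_add r
  rw [bderiv, h2.fderiv]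
  simp [Pi.single_apply]

theorem spatiallyAffine_of_affine (hU : IsOpen U) {r : ℝ} {l : Fin 5 → ℝ}
    (h : ∀ q ∈ U, f q = r + ∑ i, l i * q i) : SpatiallyAffine U f :=
  fun a _ => timeOnly_of_eq_const hU fun _ hq => bderiv_of_affine hU h hq a

/-- The prolongation of a known infinitesimal maps each equation to a combination of the equations
of the system, at every jet over `U`. -/
theorem preservesSystemOn_systemLocus (hU : IsOpen U) {V : Base → Base} (hV : ContDiffOn ℝ ∞ V U)
    {c₁ c₂ c₃ c₄ : ℝ} (h : ∀ p ∈ U, V p = infinitesimals c₁ c₂ c₃ c₄ p) :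
    PreservesSystemOn systemLocus U V := by
  have hξ : ∀ q ∈ U, component V 0 q =
      c₄ + ∑ i, (![3 * c₁ / 5, -(5 * c₃ / 6), 0, 0, 0] : Fin 5 → ℝ) i * q i := fun q hq => by
    simp [component, h q hq, infinitesimals, Fin.sum_univ_five]
    ring
  have hτ : ∀ q ∈ U, component V 1 q =
      c₂ + ∑ i, (![0, c₁, 0, 0, 0] : Fin 5 → ℝ) i * q i := fun q hq => by
    simp [component, h q hq, infinitesimals, Fin.sum_univ_five]
    ring
  have hη₁ : ∀ q ∈ U, component V 2 q =
      c₃ + ∑ i, (![0, 0, -(2 * c₁ / 5), 0, 0] : Fin 5 → ℝ) i * q i := fun q hq => by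
    simp [component, h q hq, infinitesimals, Fin.sum_univ_five]
    ring
  have hη₂ : ∀ q ∈ U, component V 3 q =
      0 + ∑ i, (![0, 0, -(2 * c₃ / 3), -(4 * c₁ / 5), 0] : Fin 5 → ℝ) i * q i := fun q hq => by
    simp [component, h q hq, infinitesimals, Fin.sum_univ_five]
    ring
  have hη₃ : ∀ q ∈ U, component V 4 q =
      0 + ∑ i, (![0, 0, 0, -(c₃ / 3), -(6 * c₁ / 5)] : Fin 5 → ℝ) i * q i := fun q hq => by
    simp [component, h q hq, infinitesimals, Fin.sum_univ_five]
    ring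
  intro z hz hp k
  have e0 : z (Sum.inr (0, 0, 1)) - 3 / 2 * basePoint z 2 * z (Sum.inr (0, 1, 0)) -
      z (Sum.inr (1, 1, 0)) = 0 := hz 0
  have e1 : z (Sum.inr (1, 0, 1)) - basePoint z 3 * z (Sum.inr (0, 1, 0)) -
      1 / 2 * basePoint z 2 * z (Sum.inr (1, 1, 0)) - z (Sum.inr (2, 1, 0)) = 0 := hz 1
  have e2 : z (Sum.inr (2, 0, 1)) + 1 / 4 * z (Sum.inr (0, 3, 0)) -
      basePoint z 4 * z (Sum.inr (0, 1, 0)) -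
      1 / 2 * basePoint z 2 * z (Sum.inr (2, 1, 0)) = 0 := hz 2
  have hξ' := spatiallyAffine_of_affine hU hξ
  have hτ' := spatiallyAffine_of_affine hU hτ
  have hη₁' := spatiallyAffine_of_affine hU hη₁
  obtain rfl | rfl | rfl : k = 0 ∨ k = 1 ∨ k = 2 := by fin_cases k <;> simp
  · rw [prolong_system_zero_eq hU hV hp]
    simp only [xD1_eq, tD1_eq, bderiv_of_affine hU hξ hp, bderiv_of_affine hU hτ hp,
      bderiv_of_affine hU hη₁ hp, bderiv_of_affine hU hη₂ hp, hη₁ _ hp, Fin.sum_univ_five,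
      Matrix.cons_val]
    linear_combination -(7 / 5) * c₁ * e0
  · rw [prolong_system_one_eq hU hV hp]
    simp only [xD1_eq, tD1_eq, bderiv_of_affine hU hξ hp, bderiv_of_affine hU hτ hp,
      bderiv_of_affine hU hη₁ hp, bderiv_of_affine hU hη₂ hp, bderiv_of_affine hU hη₃ hp,
      hη₁ _ hp, hη₂ _ hp, Fin.sum_univ_five, Matrix.cons_val]
    linear_combination -(9 / 5) * c₁ * e1 - 2 / 3 * c₃ * e0
  · rw [prolong_system_two_eq hU hV hp, hξ'.xD2_eq hp, hτ'.xD2_eq hp, hξ'.xD3_eq hU hp,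
      hτ'.xD3_eq hU hp, hη₁'.xD3_eq hU hp]
    simp only [xD1_eq, tD1_eq, bderiv_of_affine hU hξ hp, bderiv_of_affine hU hτ hp,
      bderiv_of_affine hU hη₁ hp, bderiv_of_affine hU hη₃ hp,
      hη₁ _ hp, hη₃ _ hp, Fin.sum_univ_five, Matrix.cons_val]
    linear_combination -(11 / 5) * c₁ * e2 - 1 / 3 * c₃ * e1

end Sufficiency

theorem prolongedLocus_subset_systemLocus : prolongedLocus ⊆ systemLocus := by
  intro z hz k
  exact hz k 0 0 (by revert k; decide)

theorem isPointSymmetry_iff {U : TopologicalSpace.Opens Base} (hU : IsConnected (U : Set Base))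
    (V : SmoothField U) : IsPointSymmetry U V.1 ↔
      ∃ c₁ c₂ c₃ c₄ : ℝ, ∀ p ∈ U, V.1 p = infinitesimals c₁ c₂ c₃ c₄ p := by
  constructor
  · exact exists_eq_infinitesimals U.isOpen hU.isPreconnected V.2.1
  · rintro ⟨c₁, c₂, c₃, c₄, h⟩ z hz
    exact preservesSystemOn_systemLocus U.isOpen V.2.1 h z (prolongedLocus_subset_systemLocus hz)

theorem preservesSystemOn_systemLocus_iff {U : TopologicalSpace.Opens Base}
    (hU : IsConnected (U : Set Base)) (V : SmoothField U) :
    PreservesSystemOn systemLocus U V.1 ↔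
      ∃ c₁ c₂ c₃ c₄ : ℝ, ∀ p ∈ U, V.1 p = infinitesimals c₁ c₂ c₃ c₄ p := by
  constructor
  · intro h
    exact (isPointSymmetry_iff hU V).1 fun z hz => h z (prolongedLocus_subset_systemLocus hz)
  · rintro ⟨c₁, c₂, c₃, c₄, h⟩
    exact preservesSystemOn_systemLocus U.isOpen V.2.1 h

/-! ### The Lie algebra of point symmetries -/

variable {U : TopologicalSpace.Opens Base}

theorem infinitesimals_add (c d : Fin 4 → ℝ) (p : Base) :
    infinitesimals ((c + d) 0) ((c + d) 1) ((c + d) 2) ((c + d) 3) p =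
      infinitesimals (c 0) (c 1) (c 2) (c 3) p + infinitesimals (d 0) (d 1) (d 2) (d 3) p := by
  funext i
  fin_cases i <;> simp [infinitesimals] <;> ring

theorem infinitesimals_smul (r : ℝ) (c : Fin 4 → ℝ) (p : Base) :
    infinitesimals ((r • c) 0) ((r • c) 1) ((r • c) 2) ((r • c) 3) p =
      r • infinitesimals (c 0) (c 1) (c 2) (c 3) p := by
  funext i
  fin_cases i <;> simp [infinitesimals] <;> ring

/-- On `U` the vector field `V` is given by the known infinitesimals with the parameters `c`. -/
def IsInfinitesimal (V : SmoothField U) (c : Fin 4 → ℝ) : Prop :=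
  ∀ p ∈ U, V.1 p = infinitesimals (c 0) (c 1) (c 2) (c 3) p

theorem fderiv_infinitesimals (c₁ c₂ c₃ c₄ : ℝ) (p q : Base) :
    fderiv ℝ (infinitesimals c₁ c₂ c₃ c₄) p q =
      infinitesimals c₁ c₂ c₃ c₄ q - infinitesimals c₁ c₂ c₃ c₄ 0 := by
  let l : Base →ₗ[ℝ] Base :=
    { toFun := fun q => infinitesimals c₁ c₂ c₃ c₄ q - infinitesimals c₁ c₂ c₃ c₄ 0
      map_add' := fun x y => by
        funext i
        fin_cases i <;> simp [infinitesimals] <;> ring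
      map_smul' := fun r x => by
        funext i
        fin_cases i <;> simp [infinitesimals] <;> ring }
  have h := (LinearMap.toContinuousLinearMap l).hasFDerivAt (x := p) |>.add_const
    (infinitesimals c₁ c₂ c₃ c₄ 0)
  have e : (fun q => LinearMap.toContinuousLinearMap l q + infinitesimals c₁ c₂ c₃ c₄ 0) =
      infinitesimals c₁ c₂ c₃ c₄ := by
    funext q
    simp [l]
  rw [e] at h
  rw [h.fderiv]
  rfl

theorem fderiv_of_isInfinitesimal {V : SmoothField U} {c : Fin 4 → ℝ} (h : IsInfinitesimal V c)
    {p : Base} (hp : p ∈ U) (q : Base) : fderiv ℝ V.1 p q =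
      infinitesimals (c 0) (c 1) (c 2) (c 3) q - infinitesimals (c 0) (c 1) (c 2) (c 3) 0 := by
  have h' : V.1 =ᶠ[nhds p] infinitesimals (c 0) (c 1) (c 2) (c 3) :=
    Filter.eventuallyEq_of_mem (U.isOpen.mem_nhds hp) h
  rw [h'.fderiv_eq]
  exact fderiv_infinitesimals _ _ _ _ p q

/-- The bracket in terms of the parameters `(c₁, c₂, c₃, c₄)`, which are the coordinates with
respect to the dilation, the time translation, the boost and the space translation. -/
noncomputable def bracketCoeff (c d : Fin 4 → ℝ) : Fin 4 → ℝ :=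
  ![0, c 1 * d 0 - c 0 * d 1, -(2 / 5) * (c 2 * d 0 - c 0 * d 2),
    -(5 / 6) * (c 1 * d 2 - c 2 * d 1) + 3 / 5 * (c 3 * d 0 - c 0 * d 3)]

theorem IsInfinitesimal.bracket {V W : SmoothField U} {c d : Fin 4 → ℝ} (hV : IsInfinitesimal V c)
    (hW : IsInfinitesimal W d) : IsInfinitesimal ⁅V, W⁆ (bracketCoeff c d) := by
  intro p hp
  rw [SmoothField.coe_bracket, VectorField.lieBracket, fderiv_of_isInfinitesimal hV hp,
    fderiv_of_isInfinitesimal hW hp, hV p hp, hW p hp]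
  funext i
  fin_cases i <;> simp [infinitesimals, bracketCoeff] <;> ring

theorem IsInfinitesimal.add {V W : SmoothField U} {c d : Fin 4 → ℝ} (hV : IsInfinitesimal V c)
    (hW : IsInfinitesimal W d) : IsInfinitesimal (V + W) (c + d) := fun p hp => by
  rw [infinitesimals_add, ← hV p hp, ← hW p hp]
  rfl

theorem IsInfinitesimal.smul {V : SmoothField U} {c : Fin 4 → ℝ} (hV : IsInfinitesimal V c)
    (r : ℝ) : IsInfinitesimal (r • V) (r • c) := fun p hp => by
  rw [infinitesimals_smul, ← hV p hp]
  rfl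

theorem isInfinitesimal_zero : IsInfinitesimal (0 : SmoothField U) 0 := fun p _ => by
  funext i
  fin_cases i <;> simp [infinitesimals]

theorem IsInfinitesimal.ext {V W : SmoothField U} {c : Fin 4 → ℝ} (hV : IsInfinitesimal V c)
    (hW : IsInfinitesimal W c) : V = W :=
  SmoothField.ext_on fun p hp => (hV p hp).trans (hW p hp).symm

/-- The parameters are determined by the vector field: `c₁` and `c₃` are read off its derivative,
`c₂` and `c₄` then from its value at a point. -/
theorem IsInfinitesimal.eq_zero (hU : (U : Set Base).Nonempty) {c : Fin 4 → ℝ}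
    (h : IsInfinitesimal (0 : SmoothField U) c) : c = 0 := by
  obtain ⟨p, hp⟩ := hU
  have hd : fderiv ℝ (0 : SmoothField U).1 p ![0, 1, 0, 0, 0] = 0 := by
    have : (0 : SmoothField U).1 = fun _ => 0 := rfl
    rw [this]
    simp
  rw [fderiv_of_isInfinitesimal h hp] at hd
  have hv := (h p hp).symm
  have h0 : c 0 = 0 := by simpa [infinitesimals] using congrFun hd 1
  have h2 : c 2 = 0 := by simpa [infinitesimals] using congrFun hd 0
  have h1 : c 1 = 0 := by simpa [infinitesimals, h0, h2] using congrFun hv 1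
  have h3 : c 3 = 0 := by simpa [infinitesimals, h0, h2] using congrFun hv 0
  funext i
  fin_cases i
  exacts [h0, h1, h2, h3]

theorem isInfinitesimal_V₁ : IsInfinitesimal (V₁ U) ![0, 1, 0, 0] := fun p hp => by
  refine (if_pos hp).trans ?_
  funext i
  fin_cases i <;> simp [infinitesimals]

theorem isInfinitesimal_V₂ : IsInfinitesimal (V₂ U) ![0, 0, 0, 1] := fun p hp => by
  refine (if_pos hp).trans ?_
  funext i
  fin_cases i <;> simp [infinitesimals]

theorem isInfinitesimal_V₃ : IsInfinitesimal (V₃ U) ![0, 0, 1, 0] := fun p hp => by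
  refine (if_pos hp).trans ?_
  funext i
  fin_cases i <;> simp [infinitesimals] <;> ring

theorem isInfinitesimal_V₄ : IsInfinitesimal (V₄ U) ![1, 0, 0, 0] := fun p hp => by
  refine (if_pos hp).trans ?_
  funext i
  fin_cases i <;> simp [infinitesimals] <;> ring

variable (U) in
/-- The Lie algebra of the vector fields given on `U` by the known infinitesimals. -/
def symmetryAlgebra : LieSubalgebra ℝ (SmoothField U) where
  carrier := {V | ∃ c, IsInfinitesimal V c}
  add_mem' := fun ⟨c, hc⟩ ⟨d, hd⟩ => ⟨c + d, hc.add hd⟩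
  zero_mem' := ⟨0, isInfinitesimal_zero⟩
  smul_mem' := fun r _ ⟨c, hc⟩ => ⟨r • c, hc.smul r⟩
  lie_mem' := fun ⟨c, hc⟩ ⟨d, hd⟩ => ⟨bracketCoeff c d, hc.bracket hd⟩

theorem mem_symmetryAlgebra {V : SmoothField U} :
    V ∈ symmetryAlgebra U ↔ ∃ c, IsInfinitesimal V c :=
  Iff.rfl

theorem mem_symmetryAlgebra_iff (hU : IsConnected (U : Set Base)) (V : SmoothField U) :
    V ∈ symmetryAlgebra U ↔ IsPointSymmetry U V.1 := by
  rw [isPointSymmetry_iff hU, mem_symmetryAlgebra]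
  constructor
  · rintro ⟨c, hc⟩
    exact ⟨c 0, c 1, c 2, c 3, hc⟩
  · rintro ⟨c₁, c₂, c₃, c₄, h⟩
    exact ⟨![c₁, c₂, c₃, c₄], h⟩

variable (U) in
/-- The four generators of the symmetry algebra. -/
noncomputable def generator : Fin 4 → symmetryAlgebra U :=
  ![⟨V₁ U, _, isInfinitesimal_V₁⟩, ⟨V₂ U, _, isInfinitesimal_V₂⟩, ⟨V₃ U, _, isInfinitesimal_V₃⟩,
    ⟨V₄ U, _, isInfinitesimal_V₄⟩]

/-- The order of the parameters `c₁, c₂, c₃, c₄` is that of `V₄, V₁, V₃, V₂`. -/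
theorem isInfinitesimal_sum_generator (g : Fin 4 → ℝ) :
    IsInfinitesimal (∑ i, g i • generator U i : symmetryAlgebra U).1 ![g 3, g 0, g 2, g 1] := by
  have h := (((isInfinitesimal_V₁ (U := U)).smul (g 0)).add (isInfinitesimal_V₂.smul (g 1))).add
    (isInfinitesimal_V₃.smul (g 2)) |>.add (isInfinitesimal_V₄.smul (g 3))
  have e : g 0 • ![0, 1, 0, 0] + g 1 • ![0, 0, 0, 1] + g 2 • ![0, 0, 1, 0] + g 3 • ![1, 0, 0, 0] =
      ![g 3, g 0, g 2, g 1] := by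
    funext i
    fin_cases i <;> simp
  rw [e] at h
  rw [Fin.sum_univ_four]
  exact h

/-- The generators form a basis of the symmetry algebra. -/
noncomputable def generatorBasis (hU : (U : Set Base).Nonempty) :
    Module.Basis (Fin 4) ℝ (symmetryAlgebra U) :=
  Module.Basis.mk (v := generator U)
    (Fintype.linearIndependent_iff.2 fun g hg => by
      have h := isInfinitesimal_sum_generator (U := U) g
      rw [hg] at h
      have h0 := IsInfinitesimal.eq_zero hU h
      intro i
      fin_cases i
      exacts [congrFun h0 1, congrFun h0 3, congrFun h0 2, congrFun h0 0])
    (by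
      rintro ⟨V, c, hc⟩ -
      have h := isInfinitesimal_sum_generator (U := U) ![c 1, c 3, c 2, c 0]
      have e : (![c 0, c 1, c 2, c 3] : Fin 4 → ℝ) = c := by
        funext i
        fin_cases i <;> rfl
      have hV : (⟨V, c, hc⟩ : symmetryAlgebra U) =
          ∑ i, (![c 1, c 3, c 2, c 0] : Fin 4 → ℝ) i • generator U i :=
        Subtype.ext (hc.ext (e ▸ h))
      rw [hV]
      exact Submodule.sum_mem _ fun i _ =>
        Submodule.smul_mem _ _ (Submodule.subset_span ⟨i, rfl⟩))

theorem generatorBasis_apply (hU : (U : Set Base).Nonempty) (i : Fin 4) :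
    generatorBasis hU i = generator U i := by
  simp [generatorBasis]

/-- The ideal of the symmetry algebra cut out by the vanishing of the parameters with indices in
`s`, for those `s` for which this property is inherited by brackets. -/
def parameterIdeal (s : Set (Fin 4)) (hs : ∀ c d : Fin 4 → ℝ, (∀ i ∈ s, d i = 0) →
    ∀ i ∈ s, bracketCoeff c d i = 0) : LieIdeal ℝ (symmetryAlgebra U) where
  carrier := {V | ∃ c, IsInfinitesimal V.1 c ∧ ∀ i ∈ s, c i = 0}
  add_mem' := by
    rintro V W ⟨c, hc, hc'⟩ ⟨d, hd, hd'⟩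
    exact ⟨c + d, hc.add hd, fun i hi => by simp [hc' i hi, hd' i hi]⟩
  zero_mem' := ⟨0, isInfinitesimal_zero, fun _ _ => rfl⟩
  smul_mem' := by
    rintro r V ⟨c, hc, hc'⟩
    exact ⟨r • c, hc.smul r, fun i hi => by simp [hc' i hi]⟩
  lie_mem := by
    rintro V W ⟨d, hd, hd'⟩
    obtain ⟨c, hc⟩ := V.2
    exact ⟨bracketCoeff c d, hc.bracket hd, hs c d hd'⟩

theorem bracketCoeff_zero_eq_zero (c d : Fin 4 → ℝ) (_ : ∀ i ∈ ({0} : Set (Fin 4)), d i = 0) :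
    ∀ i ∈ ({0} : Set (Fin 4)), bracketCoeff c d i = 0 := by
  simp [bracketCoeff]

theorem bracketCoeff_eq_zero_of_space (c d : Fin 4 → ℝ)
    (h : ∀ i ∈ ({0, 1, 2} : Set (Fin 4)), d i = 0) :
    ∀ i ∈ ({0, 1, 2} : Set (Fin 4)), bracketCoeff c d i = 0 := by
  simp at h
  simp [bracketCoeff, h]

/-- The derived series descends from the translations and the boost to the space translation and
then to zero. -/
theorem isSolvable_symmetryAlgebra : LieAlgebra.IsSolvable (symmetryAlgebra U) := by
  refine LieAlgebra.IsSolvable.mk (R := ℝ) (k := 3) ?_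
  have h1 : LieAlgebra.derivedSeries ℝ (symmetryAlgebra U) 1 ≤
      parameterIdeal {0} bracketCoeff_zero_eq_zero := by
    rw [LieAlgebra.derivedSeries_def, LieAlgebra.derivedSeriesOfIdeal_succ,
      LieSubmodule.lie_le_iff]
    rintro ⟨V, c, hc⟩ - ⟨W, d, hd⟩ -
    exact ⟨_, hc.bracket hd, by simp [bracketCoeff]⟩
  have h2 : LieAlgebra.derivedSeries ℝ (symmetryAlgebra U) 2 ≤
      parameterIdeal {0, 1, 2} bracketCoeff_eq_zero_of_space := by
    rw [LieAlgebra.derivedSeries_def, LieAlgebra.derivedSeriesOfIdeal_succ,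
      LieSubmodule.lie_le_iff]
    intro V hV W hW
    obtain ⟨c, hc, hc'⟩ := h1 hV
    obtain ⟨d, hd, hd'⟩ := h1 hW
    simp at hc' hd'
    exact ⟨_, hc.bracket hd, by simp [bracketCoeff, hc', hd']⟩
  rw [eq_bot_iff, LieAlgebra.derivedSeries_def, LieAlgebra.derivedSeriesOfIdeal_succ,
    LieSubmodule.lie_le_iff]
  intro V hV W hW
  obtain ⟨c, hc, hc'⟩ := h2 hV
  obtain ⟨d, hd, hd'⟩ := h2 hW
  simp at hc' hd'
  have h : bracketCoeff c d = 0 := by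
    funext i
    fin_cases i <;> simp [bracketCoeff, hc', hd']
  have hb := hc.bracket hd
  rw [h] at hb
  rw [LieSubmodule.mem_bot]
  exact Subtype.ext (hb.ext isInfinitesimal_zero)

end KaupBoussinesq

theorem mainTheorem2 (U : TopologicalSpace.Opens KaupBoussinesq.Base)
    (hU : IsConnected (U : Set KaupBoussinesq.Base)) :
    (∀ V : KaupBoussinesq.SmoothField U,
      KaupBoussinesq.IsPointSymmetry U V.1 ↔
        ∃ c₁ c₂ c₃ c₄ : ℝ, ∀ p ∈ U, V.1 p = KaupBoussinesq.infinitesimals c₁ c₂ c₃ c₄ p) ∧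
    (∀ V : KaupBoussinesq.SmoothField U,
      KaupBoussinesq.PreservesSystemOn KaupBoussinesq.systemLocus U V.1 ↔
        ∃ c₁ c₂ c₃ c₄ : ℝ, ∀ p ∈ U, V.1 p = KaupBoussinesq.infinitesimals c₁ c₂ c₃ c₄ p) ∧
    ∃ L : LieSubalgebra ℝ (KaupBoussinesq.SmoothField U),
      (∀ V : KaupBoussinesq.SmoothField U, V ∈ L ↔ KaupBoussinesq.IsPointSymmetry U V.1) ∧
      (∃ b : Module.Basis (Fin 4) ℝ L,
        (b 0 : KaupBoussinesq.SmoothField U) = KaupBoussinesq.V₁ U ∧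
        (b 1 : KaupBoussinesq.SmoothField U) = KaupBoussinesq.V₂ U ∧
        (b 2 : KaupBoussinesq.SmoothField U) = KaupBoussinesq.V₃ U ∧
        (b 3 : KaupBoussinesq.SmoothField U) = KaupBoussinesq.V₄ U ∧
        ⁅b 0, b 1⁆ = 0 ∧ ⁅b 0, b 2⁆ = -(5 / 6 : ℝ) • b 1 ∧ ⁅b 0, b 3⁆ = b 0 ∧
        ⁅b 1, b 2⁆ = 0 ∧ ⁅b 1, b 3⁆ = (3 / 5 : ℝ) • b 1 ∧ ⁅b 2, b 3⁆ = -(2 / 5 : ℝ) • b 2) ∧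
      LieAlgebra.IsSolvable L := by
  open KaupBoussinesq in
  refine ⟨isPointSymmetry_iff hU, preservesSystemOn_systemLocus_iff hU, symmetryAlgebra U,
    mem_symmetryAlgebra_iff hU, ⟨generatorBasis hU.nonempty, ?_⟩, isSolvable_symmetryAlgebra⟩
  have bracket_eq : ∀ {V W X : SmoothField U} {c d e : Fin 4 → ℝ}, IsInfinitesimal V c →
      IsInfinitesimal W d → IsInfinitesimal X e → bracketCoeff c d = e → ⁅V, W⁆ = X :=
    fun hV hW hX h => (h ▸ hV.bracket hW).ext hX
  simp only [generatorBasis_apply]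
  refine ⟨rfl, rfl, rfl, rfl, Subtype.ext ?_, Subtype.ext ?_, Subtype.ext ?_, Subtype.ext ?_,
    Subtype.ext ?_, Subtype.ext ?_⟩
  · refine bracket_eq isInfinitesimal_V₁ isInfinitesimal_V₂ isInfinitesimal_zero ?_
    funext i
    fin_cases i <;> simp [bracketCoeff]
  · refine bracket_eq isInfinitesimal_V₁ isInfinitesimal_V₃ (isInfinitesimal_V₂.smul _) ?_
    funext i
    fin_cases i <;> simp [bracketCoeff]
  · refine bracket_eq isInfinitesimal_V₁ isInfinitesimal_V₄ isInfinitesimal_V₁ ?_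
    funext i
    fin_cases i <;> simp [bracketCoeff]
  · refine bracket_eq isInfinitesimal_V₂ isInfinitesimal_V₃ isInfinitesimal_zero ?_
    funext i
    fin_cases i <;> simp [bracketCoeff]
  · refine bracket_eq isInfinitesimal_V₂ isInfinitesimal_V₄ (isInfinitesimal_V₂.smul _) ?_
    funext i
    fin_cases i <;> simp [bracketCoeff]
  · refine bracket_eq isInfinitesimal_V₃ isInfinitesimal_V₄ (isInfinitesimal_V₃.smul _) ?_
    funext i
    fin_cases i <;> simp [bracketCoeff]
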